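/- Let $sl_2$ be the Lie algebra over $\mathbb{Q}$ with basis $h,e,f$ and brackets $[h,e]=2e$, $[h,f]=-2f$, $[e,f]=h$. For $n\ge 0$ let $\mathrm{Inv}(sl_2^{\otimes n})$ be the space of tensors in $sl_2^{\otimes n}$ that are annihilated by $h$, $e$ and $f$, which act as derivations through the adjoint representation. View $sl_2^{\otimes n}$ as the subspace of $S(sl_2)^{\otimes n}$ of tensors of degree one in each factor, where $S(sl_2)$ is the symmetric algebra. A Jacobi diagram is a finite unitrivalent graph with a cyclic order of the three half-edges at each trivalent vertex, with at least one univalent vertex in each connected component, and whose univalent vertices are labelled by elements of $\{1,\dots,n\}$. Diagrams are considered up to isomorphism. The $sl_2$ weight system $W$ sends a Jacobi diagram $D$ to $W(D)\in S(sl_2)^{\otimes n}$ as follows. A copy of $$b=h\otimes e\otimes f+e\otimes f\otimes h+f\otimes h\otimes e-h\otimes f\otimes e-f\otimes e\otimes h-e\otimes h\otimes f$$ is attached to each trivalent vertex, one tensor factor for each half-edge, following the cyclic order. A copy of $c=\frac12 h\otimes h+e\otimes f+f\otimes e$ is attached to each edge that joins two univalent vertices, one tensor factor for each of them. The two copies of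 $sl_2$ on each edge that joins two trivalent vertices are contracted by the symmetric bilinear form $\kappa$ with $\kappa(h,h)=2$, $\kappa(e,f)=1$ and $\kappa(h,e)=\kappa(h,f)=\kappa(e,e)=\kappa(f,f)=0$. Finally, for each $j$, the elements of $sl_2$ carried by the univalent vertices labelled $j$ are multiplied in the $j$-th factor $S(sl_2)$. For $m\ge 2$ and labels $i_1<\dots<i_m$, the ordered linear tree on $\{i_1,\dots,i_m\}$ is the connected tree that consists of a path from the univalent vertex labelled $i_1$ through $m-2$ trivalent vertices to the univalent vertex labelled $i_m$, with, for $1\le k\le m-2$, a univalent vertex labelled $i_{k+1}$ attached to the $k$-th trivalent vertex of the path; the cyclic order at each trivalent vertex is (incoming edge of the path, attached edge, outgoing edge of the path). A Riordan partition of $\{1,\dots,n\}$ is a non-crossing partition all of whose parts have at least two elements. A Riordan tree of order $n$ is the disjoint union of the ordered linear trees on the parts of a Riordan partition of $\{1,\dots,n\}$. **Theorem.** For every $n\ge 0$, the images $W(T)$ of the Riordan trees $T$ of order $n$ are pairwise distinct and form a basis of $\mathrm{Inv}(sl_2^{\otimes n})$. In particular $\dim \mathrm{Inv}(sl_2^{\otimes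 n})=R_n$, the $n$-th Riordan number, where $R_0=1$, $R_1=0$ and $R_n=(n-1)(2R_{n-1}+3R_{n-2})/(n+1)$ for $n\ge 2$ (so that $R_2=R_3=1$). -/

import Mathlib

open scoped TensorProduct

noncomputable section

namespace RiordanTrees

/-! ### The Lie algebra `sl₂` over `ℚ` and the tensors `κ`, `c`, `b` -/

/-- The Lie algebra `sl₂` over `ℚ`, as traceless `2 × 2` matrices. -/
abbrev sl2 : Type := LieAlgebra.SpecialLinear.sl (Fin 2) ℚ

/-- The standard generator `h`. -/
def h : sl2 := ⟨!![1, 0; 0, -1], by simp [LieAlgebra.SpecialLinear.sl, Matrix.trace_fin_two]⟩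

/-- The standard generator `e`. -/
def e : sl2 := ⟨!![0, 1; 0, 0], by simp [LieAlgebra.SpecialLinear.sl, Matrix.trace_fin_two]⟩

/-- The standard generator `f`. -/
def f : sl2 := ⟨!![0, 0; 1, 0], by simp [LieAlgebra.SpecialLinear.sl, Matrix.trace_fin_two]⟩

/-- The ordered triple `(h, e, f)`. -/
def gen : Fin 3 → sl2 := ![h, e, f]

/-- The invariant form `κ(x, y) = tr (x y)`; thus `κ(h,h) = 2`, `κ(e,f) = κ(f,e) = 1`, and `κ`
vanishes on all other pairs of generators. -/
def kappa (x y : sl2) : ℚ := Matrix.trace (x.1 * y.1)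

/-- The tensor power `sl₂^{⊗n}`. -/
abbrev TensorPower (n : ℕ) : Type := ⨂[ℚ] _ : Fin n, sl2

/-- The action of `x ∈ sl₂` on `sl₂^{⊗n}`: the sum over all factors of the adjoint action of `x`
on that factor. -/
def act (n : ℕ) (x : sl2) : TensorPower n →ₗ[ℚ] TensorPower n :=
  ∑ i : Fin n, PiTensorProduct.map
    (Function.update (fun _ => LinearMap.id) i (LieAlgebra.ad ℚ sl2 x : sl2 →ₗ[ℚ] sl2))

/-- `Inv(sl₂^{⊗n})`: the tensors that `h`, `e` and `f` send to zero. -/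
def Inv (n : ℕ) : Submodule ℚ (TensorPower n) :=
  LinearMap.ker (act n h) ⊓ LinearMap.ker (act n e) ⊓ LinearMap.ker (act n f)

/-- `S(sl₂)^{⊗n}`, the `n`-fold tensor power of the symmetric algebra, a commutative algebra. -/
abbrev SymTensorPower (n : ℕ) : Type := ⨂[ℚ] _ : Fin n, SymmetricAlgebra ℚ sl2

/-- The embedding of `sl₂^{⊗n}` in `S(sl₂)^{⊗n}` as the tensors of degree one in each factor. -/
def incl (n : ℕ) : TensorPower n →ₗ[ℚ] SymTensorPower n :=
  PiTensorProduct.map (fun _ => SymmetricAlgebra.ι ℚ sl2)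

/-- `place j x` is `1 ⊗ ⋯ ⊗ x ⊗ ⋯ ⊗ 1`, with `x ∈ sl₂` at the `j`-th position. -/
def place {n : ℕ} (j : Fin n) : sl2 →ₗ[ℚ] SymTensorPower n :=
  (PiTensorProduct.singleAlgHom (R := ℚ) (A := fun _ : Fin n => SymmetricAlgebra ℚ sl2)
    j).toLinearMap ∘ₗ SymmetricAlgebra.ι ℚ sl2

/-- The Casimir tensor `c = ½ h ⊗ h + f ⊗ e + e ⊗ f`, with its first factor at position `i` and its
second factor at position `j` (the two are multiplied if `i = j`). -/
def casimir {n : ℕ} (i j : Fin n) : SymTensorPower n :=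
  (1 / 2 : ℚ) • (place i h * place j h) + place i f * place j e + place i e * place j f

/-! ### Jacobi diagrams -/

/-- The vertex to which a half-edge belongs: `Sum.inl u` is the only half-edge at the univalent
vertex `u`, and `Sum.inr (v, i)` is the `i`-th half-edge at the trivalent vertex `v`. -/
def vertexOf {U V : Type} : U ⊕ V × Fin 3 → U ⊕ V := Sum.map id Prod.fst

/-- A Jacobi diagram with univalent vertices labelled by `Fin n`: a finite graph (loops and multiple
edges are allowed) whose vertices are univalent (the set `U`) or trivalent (the set `V`). The edge
`x` consists of the half-edges `ends (x, false)` and `ends (x, true)`, and each half-edge lies in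
exactly one edge, on one side. The half-edges at `v : V` are `(v, 0)`, `(v, 1)`, `(v, 2)`, in this
cyclic order. Each connected component has a univalent vertex. -/
structure JacobiDiagram (n : ℕ) where
  /-- univalent vertices -/
  U : Type
  /-- trivalent vertices -/
  V : Type
  /-- edges -/
  E : Type
  [fintypeU : Fintype U]
  [fintypeV : Fintype V]
  [fintypeE : Fintype E]
  /-- the two half-edges of an edge -/
  ends : E × Bool → U ⊕ V × Fin 3
  ends_bijective : Function.Bijective ends
  /-- every trivalent vertex is connected by a path to some univalent vertex -/
  exists_univalent : ∀ v : V, ∃ u : U, Relation.EqvGen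
    (fun a b => ∃ x : E, vertexOf (ends (x, false)) = a ∧ vertexOf (ends (x, true)) = b)
    (Sum.inl u) (Sum.inr v)
  /-- labels of the univalent vertices -/
  label : U → Fin n

attribute [instance] JacobiDiagram.fintypeU JacobiDiagram.fintypeV JacobiDiagram.fintypeE

namespace JacobiDiagram

variable {n : ℕ}

/-- An isomorphism of Jacobi diagrams: an isomorphism of graphs that preserves the labels and the
cyclic order at each trivalent vertex. The half-edges at `v` are rotated by `rot v`; the order in
which the two half-edges of an edge are listed is not part of the diagram, and it is reversed if
`flip` says so. -/
structure Iso (D D' : JacobiDiagram n) where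
  onU : D.U ≃ D'.U
  onV : D.V ≃ D'.V
  onE : D.E ≃ D'.E
  rot : D.V → Fin 3
  flip : D.E → Bool
  label_onU : ∀ u, D'.label (onU u) = D.label u
  ends_onE : ∀ x s, D'.ends (onE x, xor (flip x) s) =
    Sum.map onU (fun p : D.V × Fin 3 => (onV p.1, p.2 + rot p.1)) (D.ends (x, s))

/-- The disjoint union of a finite family of Jacobi diagrams. -/
def disjUnion {ι : Type} [Fintype ι] (D : ι → JacobiDiagram n) : JacobiDiagram n where
  U := Σ i, (D i).U
  V := Σ i, (D i).V
  E := Σ i, (D i).E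
  ends p := Sum.map (Sigma.mk p.1.1) (fun q => (⟨p.1.1, q.1⟩, q.2)) ((D p.1.1).ends (p.1.2, p.2))
  ends_bijective := by
    constructor
    · rintro ⟨⟨i, x⟩, s⟩ ⟨⟨j, y⟩, t⟩ hxy
      have hij : i = j := by
        rcases hx : (D i).ends (x, s) with u | ⟨v, k⟩ <;>
          rcases hy : (D j).ends (y, t) with u' | ⟨v', k'⟩ <;> simp_all
      subst hij
      have key : (D i).ends (x, s) = (D i).ends (y, t) := by
        rcases hx : (D i).ends (x, s) with u | ⟨v, k⟩ <;>
          rcases hy : (D i).ends (y, t) with u' | ⟨v', k'⟩ <;> simp_all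
      have := (D i).ends_bijective.1 key
      simp_all
    · rintro (⟨i, u⟩ | ⟨⟨i, v⟩, k⟩)
      · obtain ⟨⟨x, s⟩, hx⟩ := (D i).ends_bijective.2 (Sum.inl u)
        exact ⟨⟨⟨i, x⟩, s⟩, by simp [hx]⟩
      · obtain ⟨⟨x, s⟩, hx⟩ := (D i).ends_bijective.2 (Sum.inr (v, k))
        exact ⟨⟨⟨i, x⟩, s⟩, by simp [hx]⟩
  exists_univalent := by
    rintro ⟨i, v⟩
    obtain ⟨u, hu⟩ := (D i).exists_univalent v
    refine ⟨⟨i, u⟩, ?_⟩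
    have key : ∀ a b, Relation.EqvGen (fun a b => ∃ x : (D i).E,
        vertexOf ((D i).ends (x, false)) = a ∧ vertexOf ((D i).ends (x, true)) = b) a b →
        Relation.EqvGen (fun a b => ∃ x : (Σ i, (D i).E),
          vertexOf (Sum.map (Sigma.mk x.1) (fun q : (D x.1).V × Fin 3 => ((⟨x.1, q.1⟩ : Σ i, (D i).V), q.2))
            ((D x.1).ends (x.2, false))) = a ∧
          vertexOf (Sum.map (Sigma.mk x.1) (fun q : (D x.1).V × Fin 3 => ((⟨x.1, q.1⟩ : Σ i, (D i).V), q.2))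
            ((D x.1).ends (x.2, true))) = b)
          (Sum.map (fun u => (⟨i, u⟩ : Σ i, (D i).U)) (fun v => (⟨i, v⟩ : Σ i, (D i).V)) a)
          (Sum.map (fun u => (⟨i, u⟩ : Σ i, (D i).U)) (fun v => (⟨i, v⟩ : Σ i, (D i).V)) b) := by
      intro a b hab
      induction hab with
      | rel a b hab =>
        obtain ⟨x, rfl, rfl⟩ := hab
        refine Relation.EqvGen.rel _ _ ⟨⟨i, x⟩, ?_, ?_⟩
        · rcases (D i).ends (x, false) with u | ⟨v, k⟩ <;> rfl
        · rcases (D i).ends (x, true) with u | ⟨v, k⟩ <;> rfl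
      | refl a => exact Relation.EqvGen.refl _
      | symm a b _ ih => exact Relation.EqvGen.symm _ _ ih
      | trans a b c _ _ ih₁ ih₂ => exact Relation.EqvGen.trans _ _ _ ih₁ ih₂
    exact key _ _ hu
  label p := (D p.1).label p.2

/-- The linear tree with `k + 2` univalent vertices, labelled `i 0, …, i (k + 1)` along the tree. Its
spine is a path of `k + 1` edges `Sum.inl 0, …, Sum.inl k` from the univalent vertex `0` through the
trivalent vertices `0, …, k - 1` to the univalent vertex `k + 1`; the edge `Sum.inr v` joins the
univalent vertex `v + 1` to the trivalent vertex `v`. The cyclic order at a trivalent vertex is: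
incoming spine edge, leg, outgoing spine edge. For `k = 0` it is a strut. -/
def linearTree (k : ℕ) (i : Fin (k + 2) → Fin n) : JacobiDiagram n where
  U := Fin (k + 2)
  V := Fin k
  E := Fin (k + 1) ⊕ Fin k
  ends
    | (Sum.inl j, false) => Fin.cases (Sum.inl 0) (fun v => Sum.inr (v, 2)) j
    | (Sum.inl j, true) => Fin.lastCases (Sum.inl (Fin.last (k + 1))) (fun v => Sum.inr (v, 0)) j
    | (Sum.inr v, false) => Sum.inl v.castSucc.succ
    | (Sum.inr v, true) => Sum.inr (v, 1)
  ends_bijective := by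
    rw [Fintype.bijective_iff_surjective_and_card]
    constructor
    · rintro (u | ⟨v, r⟩)
      · refine Fin.cases ⟨(Sum.inl 0, false), rfl⟩ (fun u => ?_) u
        refine Fin.lastCases ⟨(Sum.inl (Fin.last k), true), ?_⟩ (fun v => ?_) u
        · simp
        · exact ⟨(Sum.inr v, false), rfl⟩
      · fin_cases r
        · exact ⟨(Sum.inl v.castSucc, true), by simp⟩
        · exact ⟨(Sum.inr v, true), rfl⟩
        · exact ⟨(Sum.inl v.succ, false), by simp⟩
    · simp; ring
  exists_univalent v := ⟨v.castSucc.succ, Relation.EqvGen.rel _ _ ⟨Sum.inr v, rfl, rfl⟩⟩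
  label := i

/-! ### The `sl₂` weight system -/

/-- The contribution of the edge `x` when `gen (σ v i)` is attached to the half-edge `(v, i)`:
the contraction by `κ` for an edge between trivalent vertices, the factor carried by the leg for an
edge with one univalent end, and the Casimir tensor for a strut. -/
def edgeFactor (D : JacobiDiagram n) (σ : D.V → Equiv.Perm (Fin 3)) (x : D.E) : SymTensorPower n :=
  match D.ends (x, false), D.ends (x, true) with
  | Sum.inl u, Sum.inl u' => casimir (D.label u) (D.label u')
  | Sum.inl u, Sum.inr (v, i) => place (D.label u) (gen (σ v i))
  | Sum.inr (v, i), Sum.inl u => place (D.label u) (gen (σ v i))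
  | Sum.inr (v, i), Sum.inr (w, j) => algebraMap ℚ (SymTensorPower n)
      (kappa (gen (σ v i)) (gen (σ w j)))

open Classical in
/-- The `sl₂` weight system: attach a copy of `b = ∑_σ sgn(σ) gen (σ 0) ⊗ gen (σ 1) ⊗ gen (σ 2)`
(sum over the permutations `σ` of three letters) to each trivalent vertex, following the cyclic
order, a copy of `c` to each strut, contract along the edges between trivalent vertices by `κ`, and
multiply, in the `j`-th factor of `S(sl₂)^{⊗n}`, the elements carried by the univalent vertices
labelled `j`. Here all copies of `b` are expanded. The value on a disjoint union is the product of
the values on the components. -/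
def W (D : JacobiDiagram n) : SymTensorPower n :=
  ∑ σ : D.V → Equiv.Perm (Fin 3),
    (∏ v, ((Equiv.Perm.sign (σ v) : ℤ) : ℚ)) • ∏ x, D.edgeFactor σ x

end JacobiDiagram

/-! ### Riordan partitions, Riordan trees, Riordan numbers -/

/-- A Riordan partition: a non-crossing partition of `Fin n` all of whose parts have at least two
elements. -/
structure IsRiordanPartition {n : ℕ} (P : Finpartition (Finset.univ : Finset (Fin n))) : Prop where
  two_le_card : ∀ p ∈ P.parts, 2 ≤ p.card
  noncrossing : ∀ p ∈ P.parts, ∀ q ∈ P.parts, p ≠ q →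
    ∀ a ∈ p, ∀ b ∈ q, ∀ c ∈ p, ∀ d ∈ q, ¬ (a < b ∧ b < c ∧ c < d)

/-- The ordered linear tree on a set `p` of at least two labels: the linear tree whose labels are the
elements of `p` in increasing order. -/
def orderedLinearTree {n : ℕ} (p : Finset (Fin n)) (hp : 2 ≤ p.card) : JacobiDiagram n :=
  JacobiDiagram.linearTree (p.card - 2)
    (p.orderEmbOfFin (show p.card = p.card - 2 + 2 by omega))

/-- A Riordan tree of order `n`: a Jacobi diagram that is (isomorphic to) the disjoint union of the
ordered linear trees on the parts of a Riordan partition. -/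
def IsRiordanTree {n : ℕ} (T : JacobiDiagram n) : Prop :=
  ∃ (P : Finpartition (Finset.univ : Finset (Fin n))) (hP : IsRiordanPartition P),
    Nonempty (T.Iso (JacobiDiagram.disjUnion fun p : P.parts =>
      orderedLinearTree p.1 (hP.two_le_card p.1 p.2)))

/-- The Riordan numbers, given by `R₀ = 1`, `R₁ = 0` and
`R_m = (m - 1) (2 R_{m-1} + 3 R_{m-2}) / (m + 1)` for `m ≥ 2`; thus `R₂ = R₃ = 1`. -/
def riordanNumber : ℕ → ℚ
  | 0 => 1
  | 1 => 0
  | m + 2 => ((m : ℚ) + 1) * (2 * riordanNumber (m + 1) + 3 * riordanNumber m) / ((m : ℚ) + 3)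

end RiordanTrees

end

/-! The dimension of the invariants is squeezed between two counts. A word in `f`, `h`, `e` is read
as a path: up, level, down, never below zero and never level at height zero (`IsPath`). The chain is
#Riordan partitions = dim span of the `W(T)` ≤ dim Inv ≤ #paths ≤ #Riordan partitions, so all terms
agree, and independent invariants of the right number form a basis.

The span consists of invariants (`riordanValue_mem`) because every tree is built from equivariant
tensors; this is checked over the dual numbers, where invariance means being fixed by the algebra
map `1 + ε x`. The values are independent because their leading words differ: for the lexicographic
order with `e < h < f`, the leading word of an ordered linear tree is `f h ⋯ h e`, with coefficient
1, so the union over a partition leads with the word that marks the first and last element of each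
part (`code_riordanValue`). A non-crossing partition with parts of size at least two is recovered
from these marks (`IsRiordanPartition.word_injective`).

The upper bound (`IsHighest.eq_zero`) says that an invariant is determined by its coefficients on
paths. The first tensor factor is split off, and the three resulting slices are shown to be highest
weight vectors one after the other; a positive definite form with `f` adjoint to `e` replaces the
representation theory of `sl₂`. Each path comes from a partition by matching steps at the same level
(`IsPath.exists_word_eq`). The paths are counted by differences of trinomial coefficients, which
satisfy the Riordan recurrence (`card_isPath`, `riordanNumber_eq`). -/

noncomputable section

namespace RiordanTrees

variable {n : ℕ}

/-! ### Coordinates on `sl₂` -/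

/-- The coordinates of an element of `sl₂` with respect to `(h, e, f)`. -/
def coordEquiv : sl2 ≃ₗ[ℚ] (Fin 3 → ℚ) where
  toFun x := ![x.1 0 0, x.1 0 1, x.1 1 0]
  invFun v := v 0 • h + v 1 • e + v 2 • f
  map_add' x y := by ext i; fin_cases i <;> simp
  map_smul' c x := by ext i; fin_cases i <;> simp
  left_inv x := by
    have hx : x.1 0 0 + x.1 1 1 = 0 := by
      have hx : Matrix.trace x.1 = 0 := x.2
      rwa [Matrix.trace_fin_two] at hx
    ext i j
    fin_cases i <;> fin_cases j <;> simp [h, e, f]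
    linarith
  right_inv v := by ext i; fin_cases i <;> simp [h, e, f]

/-- The basis `(h, e, f)` of `sl₂`. -/
def genBasis : Module.Basis (Fin 3) ℚ sl2 := Module.Basis.ofEquivFun coordEquiv

lemma coe_genBasis : ⇑genBasis = gen := by
  funext i
  fin_cases i <;> simp [genBasis, Module.Basis.coe_ofEquivFun, coordEquiv, gen]

lemma genBasis_apply (a : Fin 3) : genBasis a = gen a := by rw [coe_genBasis]

/-- The values of `κ` on pairs of generators. -/
lemma kappa_gen (a b : Fin 3) :
    kappa (gen a) (gen b) = !![2, 0, 0; 0, 0, 1; 0, 1, 0] a b := by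
  fin_cases a <;> fin_cases b <;>
    simp [kappa, gen, h, e, f, Matrix.trace_fin_two]
  norm_num

lemma kappa_comm (x y : sl2) : kappa x y = kappa y x := Matrix.trace_mul_comm _ _

/-- The matrices of `ad h`, `ad e`, `ad f` with respect to `(h, e, f)`. -/
def adMatrix : Fin 3 → Matrix (Fin 3) (Fin 3) ℚ :=
  ![!![0, 0, 0; 0, 2, 0; 0, 0, -2], !![0, 0, 1; -2, 0, 0; 0, 0, 0],
    !![0, -1, 0; 0, 0, 0; 2, 0, 0]]

lemma lie_gen (y a : Fin 3) : ⁅gen y, gen a⁆ = ∑ b, adMatrix y b a • gen b := by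
  apply Subtype.ext
  fin_cases y <;> fin_cases a <;> ext i j <;> fin_cases i <;> fin_cases j <;>
    simp [gen, h, e, f, adMatrix, Fin.sum_univ_three, Ring.lie_def] <;> norm_num

lemma genBasis_repr_lie (y : Fin 3) (x : sl2) (a : Fin 3) :
    genBasis.repr ⁅gen y, x⁆ a = ∑ b, adMatrix y a b * genBasis.repr x b := by
  have key : genBasis.coord a ∘ₗ (LieAlgebra.ad ℚ sl2 (gen y) : sl2 →ₗ[ℚ] sl2) =
      ∑ b, adMatrix y a b • genBasis.coord b := by
    refine genBasis.ext fun c => ?_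
    rw [LinearMap.comp_apply, LieAlgebra.ad_apply, genBasis_apply, lie_gen, ← coe_genBasis]
    simp [Finsupp.single_apply]
  simpa using LinearMap.congr_fun key x

/-! ### Algebra maps out of `S(sl₂)^{⊗n}` -/

/-- The algebra map on `S(sl₂)^{⊗n}` given by a linear map on each copy of `sl₂`. -/
def placeLift {A : Type*} [CommRing A] [Algebra ℚ A] (φ : Fin n → sl2 →ₗ[ℚ] A) :
    SymTensorPower n →ₐ[ℚ] A :=
  PiTensorProduct.liftAlgHom
    ((MultilinearMap.mkPiAlgebra ℚ (Fin n) A).compLinearMap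
      fun j => (SymmetricAlgebra.lift (φ j)).toLinearMap)
    (by simp) (by intro x y; simp [Finset.prod_mul_distrib])

lemma place_apply (j : Fin n) (x : sl2) :
    place j x = PiTensorProduct.tprod ℚ
      (Function.update (fun _ => (1 : SymmetricAlgebra ℚ sl2)) j (SymmetricAlgebra.ι ℚ sl2 x)) := rfl

@[simp] lemma placeLift_place {A : Type*} [CommRing A] [Algebra ℚ A] (φ : Fin n → sl2 →ₗ[ℚ] A)
    (j : Fin n) (x : sl2) : placeLift φ (place j x) = φ j x := by
  have : placeLift φ (place j x) = ∏ i, SymmetricAlgebra.lift (φ i)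
      (Function.update (fun _ => (1 : SymmetricAlgebra ℚ sl2)) j
        (SymmetricAlgebra.ι ℚ sl2 x) i) := by
    rw [place_apply]
    exact PiTensorProduct.lift.tprod _
  rw [this, Finset.prod_eq_single j]
  · simp
  · intro i _ hi; simp [hi]
  · simp

lemma incl_tprod (v : Fin n → sl2) :
    incl n (PiTensorProduct.tprod ℚ v) = ∏ j, place j (v j) := by
  simp_rw [place_apply, ← PiTensorProduct.tprod_prod]
  rw [incl, PiTensorProduct.map_tprod]
  congr 1
  funext i
  rw [Finset.prod_apply, Finset.prod_eq_single i]
  · simp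
  · intro j _ hj; simp [Function.update_of_ne hj.symm]
  · simp

/-- The projection of `S(sl₂)` to its degree one part. -/
def degreeOne : SymmetricAlgebra ℚ sl2 →ₗ[ℚ] sl2 :=
  ∑ a, LinearMap.toSpanSingleton ℚ sl2 (gen a) ∘ₗ Polynomial.lcoeff ℚ 1 ∘ₗ
    (SymmetricAlgebra.lift
      (LinearMap.toSpanSingleton ℚ (Polynomial ℚ) Polynomial.X ∘ₗ genBasis.coord a)).toLinearMap

lemma degreeOne_ι (x : sl2) : degreeOne (SymmetricAlgebra.ι ℚ sl2 x) = x := by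
  conv_rhs => rw [← genBasis.sum_repr x]
  simp [degreeOne, genBasis_apply]

/-- Projecting each factor of `S(sl₂)^{⊗n}` to degree one is a left inverse. -/
lemma incl_injective : Function.Injective (incl n) := by
  have : PiTensorProduct.map (fun _ : Fin n => degreeOne) ∘ₗ incl n = LinearMap.id := by
    rw [incl, ← PiTensorProduct.map_comp, ← PiTensorProduct.map_id]
    congr 1
    funext i
    exact LinearMap.ext degreeOne_ι
  exact Function.LeftInverse.injective (g := PiTensorProduct.map (fun _ : Fin n => degreeOne))
    fun x => LinearMap.congr_fun this x

/-! ### The weight system on linear trees, recursively -/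

/-- The value of a caterpillar with an input at its root, when the generator `a` is fed to the root.
The `j`-th leg carries `p j`. -/
def branch {A : Type*} [CommRing A] : ∀ k : ℕ, (Fin (k + 1) → Fin 3 → A) → Fin 3 → A
  | 0, p => p 0
  | k + 1, p =>
    ![2 * (p 0 1 * branch k (Fin.tail p) 2 - p 0 2 * branch k (Fin.tail p) 1),
      p 0 0 * branch k (Fin.tail p) 1 - p 0 1 * branch k (Fin.tail p) 0,
      p 0 2 * branch k (Fin.tail p) 0 - p 0 0 * branch k (Fin.tail p) 2]

/-- The value of a linear tree with `k + 2` legs: the Casimir tensor with `branch` applied to its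
second factor. The `j`-th leg carries `p j`. -/
def treeValue {A : Type*} [CommRing A] [Algebra ℚ A] (k : ℕ) (p : Fin (k + 2) → Fin 3 → A) : A :=
  (1 / 2 : ℚ) • (p 0 0 * branch k (Fin.tail p) 0) + p 0 2 * branch k (Fin.tail p) 1 +
    p 0 1 * branch k (Fin.tail p) 2

lemma sum_perm_three {M : Type*} [AddCommGroup M] [Module ℚ M] (F : Fin 3 → Fin 3 → Fin 3 → M) :
    ∑ s : Equiv.Perm (Fin 3), ((Equiv.Perm.sign s : ℤ) : ℚ) • F (s 0) (s 1) (s 2) =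
      F 0 1 2 + F 1 2 0 + F 2 0 1 - F 0 2 1 - F 2 1 0 - F 1 0 2 := by
  have huniv : (Finset.univ : Finset (Equiv.Perm (Fin 3))) =
      {1, finRotate 3, (finRotate 3)⁻¹, Equiv.swap 1 2, Equiv.swap 0 2, Equiv.swap 0 1} := by
    decide
  have h1 : Equiv.Perm.sign (finRotate 3) = 1 := by decide
  rw [huniv, Finset.sum_insert (by decide), Finset.sum_insert (by decide),
    Finset.sum_insert (by decide), Finset.sum_insert (by decide), Finset.sum_insert (by decide),
    Finset.sum_singleton]
  have e1 : ((finRotate 3)⁻¹ 0 : Fin 3) = 2 := by decide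
  have e2 : ((finRotate 3)⁻¹ 1 : Fin 3) = 0 := by decide
  have e3 : ((finRotate 3)⁻¹ 2 : Fin 3) = 1 := by decide
  have e4 : (finRotate 3 0 : Fin 3) = 1 := by decide
  have e5 : (finRotate 3 1 : Fin 3) = 2 := by decide
  have e6 : (finRotate 3 2 : Fin 3) = 0 := by decide
  have s1 : (Equiv.swap (1 : Fin 3) 2) 0 = 0 := by decide
  have s2 : (Equiv.swap (0 : Fin 3) 2) 1 = 1 := by decide
  have s3 : (Equiv.swap (0 : Fin 3) 1) 2 = 2 := by decide
  rw [Equiv.Perm.sign_inv, h1, Equiv.Perm.sign_swap (by decide), Equiv.Perm.sign_swap (by decide),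
    Equiv.Perm.sign_swap (by decide), e1, e2, e3, e4, e5, e6, s1, s2, s3]
  simp
  abel

/-- The generator on the outgoing side of the spine edge `j`, if `a` is fed to the root. -/
def spineState {k : ℕ} (σ : Fin k → Equiv.Perm (Fin 3)) (a : Fin 3) : Fin (k + 1) → Fin 3 :=
  Fin.cases a fun v => σ v 2

/-- The trivalent vertices are summed out one at a time from the root. At each vertex `κ` allows a
single generator on the incoming half-edge, so two of the six permutations survive; these are the
two terms in the recursion for `branch`. -/
lemma branch_eq_sum {A : Type*} [CommRing A] [Algebra ℚ A] (k : ℕ) (p : Fin (k + 1) → Fin 3 → A)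
    (a : Fin 3) :
    branch k p a = ∑ σ : Fin k → Equiv.Perm (Fin 3),
      (∏ v, ((Equiv.Perm.sign (σ v) : ℤ) : ℚ)) •
        ((∏ v, p v.castSucc (σ v 1)) *
          ((∏ v, algebraMap ℚ A (kappa (gen (spineState σ a v.castSucc)) (gen (σ v 0)))) *
            p (Fin.last k) (spineState σ a (Fin.last k)))) := by
  induction k generalizing a with
  | zero => simp [branch, spineState]
  | succ k ih =>
    rw [← (Fin.consEquiv fun _ => Equiv.Perm (Fin 3)).sum_comp, Fintype.sum_prod_type]
    -- Once the permutation `s` at the first vertex is fixed, the rest is a caterpillar whose root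
    -- receives the generator on the outgoing half-edge, `s 2`.
    have key : ∀ s : Equiv.Perm (Fin 3), ∑ σ : Fin k → Equiv.Perm (Fin 3),
      (∏ v, ((Equiv.Perm.sign ((Fin.cons s σ : Fin (k + 1) → Equiv.Perm (Fin 3)) v) : ℤ) : ℚ)) •
        ((∏ v, p v.castSucc ((Fin.cons s σ : Fin (k + 1) → Equiv.Perm (Fin 3)) v 1)) *
          ((∏ v, algebraMap ℚ A (kappa
            (gen (spineState (Fin.cons s σ : Fin (k + 1) → Equiv.Perm (Fin 3)) a v.castSucc))
            (gen ((Fin.cons s σ : Fin (k + 1) → Equiv.Perm (Fin 3)) v 0)))) *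
            p (Fin.last (k + 1)) (spineState (Fin.cons s σ : Fin (k + 1) → Equiv.Perm (Fin 3)) a
              (Fin.last (k + 1))))) =
      ((Equiv.Perm.sign s : ℤ) : ℚ) • (algebraMap ℚ A (kappa (gen a) (gen (s 0))) *
        p 0 (s 1) * branch k (Fin.tail p) (s 2)) := by
      intro s
      rw [ih, Finset.mul_sum, Finset.smul_sum]
      refine Finset.sum_congr rfl fun σ _ => ?_
      have hs : ∀ j : Fin (k + 1),
          spineState (Fin.cons s σ : Fin (k + 1) → Equiv.Perm (Fin 3)) a j.succ =
            spineState σ (s 2) j := by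
        intro j
        refine Fin.cases ?_ (fun v => ?_) j
        · rfl
        · rfl
      have h0 : spineState (Fin.cons s σ : Fin (k + 1) → Equiv.Perm (Fin 3)) a 0 = a := rfl
      rw [Fin.prod_univ_succ, Fin.prod_univ_succ, Fin.prod_univ_succ]
      simp only [Fin.cons_zero, Fin.cons_succ, Fin.castSucc_zero, ← Fin.succ_castSucc, hs, h0,
        ← Fin.succ_last, Fin.tail]
      rw [mul_smul_comm, smul_smul]
      congr 1
      ring
    refine Eq.trans ?_ (Finset.sum_congr rfl fun s _ => (key s).symm)
    rw [sum_perm_three fun x y z => algebraMap ℚ A (kappa (gen a) (gen x)) * p 0 y *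
      branch k (Fin.tail p) z]
    simp only [kappa_gen]
    have h2 : algebraMap ℚ A 2 = 2 := map_ofNat _ 2
    fin_cases a <;> simp [branch, h2]
    ring

/-! ### Evaluation of the weight system on linear trees. -/

namespace JacobiDiagram

section edgeFactor

variable {D : JacobiDiagram n} {σ : D.V → Equiv.Perm (Fin 3)} {x : D.E}

lemma edgeFactor_leg_leg {u u' : D.U} {j j' : Fin n} (h₁ : D.ends (x, false) = Sum.inl u)
    (h₂ : D.ends (x, true) = Sum.inl u') (hu : D.label u = j) (hu' : D.label u' = j') :
    D.edgeFactor σ x = casimir j j' := by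
  simp only [edgeFactor, h₁, h₂, hu, hu']

lemma edgeFactor_leg_inner {u : D.U} {v : D.V} {i a : Fin 3} {j : Fin n}
    (h₁ : D.ends (x, false) = Sum.inl u) (h₂ : D.ends (x, true) = Sum.inr (v, i))
    (hu : D.label u = j) (hv : σ v i = a) :
    D.edgeFactor σ x = place j (gen a) := by
  simp only [edgeFactor, h₁, h₂, hu, hv]

lemma edgeFactor_inner_leg {u : D.U} {v : D.V} {i a : Fin 3} {j : Fin n}
    (h₁ : D.ends (x, false) = Sum.inr (v, i)) (h₂ : D.ends (x, true) = Sum.inl u)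
    (hu : D.label u = j) (hv : σ v i = a) :
    D.edgeFactor σ x = place j (gen a) := by
  simp only [edgeFactor, h₁, h₂, hu, hv]

lemma edgeFactor_inner_inner {v w : D.V} {i j a b : Fin 3}
    (h₁ : D.ends (x, false) = Sum.inr (v, i)) (h₂ : D.ends (x, true) = Sum.inr (w, j))
    (hv : σ v i = a) (hw : σ w j = b) :
    D.edgeFactor σ x = algebraMap ℚ (SymTensorPower n) (kappa (gen a) (gen b)) := by
  simp only [edgeFactor, h₁, h₂, hv, hw]

end edgeFactor

/-- The sum in `W` runs over functions on `D.V`, and its `Fintype` instance uses classical equality;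
here any instance is allowed, such as the usual one on `Fin k`. -/
lemma W_eq_sum (D : JacobiDiagram n) [inst : DecidableEq D.V] :
    D.W = ∑ σ : D.V → Equiv.Perm (Fin 3),
      (∏ v, ((Equiv.Perm.sign (σ v) : ℤ) : ℚ)) • ∏ x, D.edgeFactor σ x := by
  unfold W
  congr!

lemma W_linearTree_eq_sum (k : ℕ) (i : Fin (k + 2) → Fin n) :
    (linearTree k i).W = ∑ σ : Fin k → Equiv.Perm (Fin 3),
      (∏ v, ((Equiv.Perm.sign (σ v) : ℤ) : ℚ)) •
        ((∏ x : Fin (k + 1), (linearTree k i).edgeFactor σ (Sum.inl x)) *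
          ∏ v : Fin k, place (i v.castSucc.succ) (gen (σ v 1))) := by
  have h1 : ∀ σ : Fin k → Equiv.Perm (Fin 3), ∏ x, (linearTree k i).edgeFactor σ x =
      (∏ x : Fin (k + 1), (linearTree k i).edgeFactor σ (Sum.inl x)) *
          ∏ v : Fin k, place (i v.castSucc.succ) (gen (σ v 1)) := fun σ =>
    Fintype.prod_sum_type (α₁ := Fin (k + 1)) (α₂ := Fin k) _
  simp only [← h1]
  exact W_eq_sum (D := linearTree k i) (inst := instDecidableEqFin k)

lemma ends_linearTree_castSucc (k : ℕ) (i : Fin (k + 2) → Fin n) (v : Fin k) :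
    (linearTree k i).ends (Sum.inl v.castSucc, true) = Sum.inr (v, (0 : Fin 3)) := by
  simp [linearTree]

lemma ends_linearTree_last (k : ℕ) (i : Fin (k + 2) → Fin n) :
    (linearTree k i).ends (Sum.inl (Fin.last k), true) = Sum.inl (Fin.last (k + 1)) := by
  simp [linearTree]

lemma prod_spine (k : ℕ) (i : Fin (k + 3) → Fin n) (s : Equiv.Perm (Fin 3))
    (σ : Fin k → Equiv.Perm (Fin 3)) :
    ∏ x : Fin (k + 2), (linearTree (k + 1) i).edgeFactor
        (Fin.cons s σ : Fin (k + 1) → Equiv.Perm (Fin 3)) (Sum.inl x) =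
      place (i 0) (gen (s 0)) *
        ((∏ v : Fin k, algebraMap ℚ (SymTensorPower n)
          (kappa (gen (spineState σ (s 2) v.castSucc)) (gen (σ v 0)))) *
        place (i (Fin.last k).succ.succ) (gen (spineState σ (s 2) (Fin.last k)))) := by
  have hs : ∀ j : Fin (k + 1), (Fin.cons s σ : Fin (k + 1) → Equiv.Perm (Fin 3)) j 2 =
      spineState σ (s 2) j := fun j => by
    refine Fin.cases ?_ (fun v => ?_) j <;> rfl
  rw [Fin.prod_univ_succ, Fin.prod_univ_castSucc]
  have h0 : (linearTree (k + 1) i).ends (Sum.inl (0 : Fin (k + 2)), true) =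
    Sum.inr ((0 : Fin (k + 1)), (0 : Fin 3)) := 
    ends_linearTree_castSucc (k + 1) i 0
  have h1 (v : Fin k) : (linearTree (k + 1) i).ends (Sum.inl v.castSucc.succ, true) =
      Sum.inr (v.succ, (0 : Fin 3)) :=
    (congrArg (fun j => (linearTree (k + 1) i).ends (Sum.inl j, true))
        (Fin.succ_castSucc v)).trans (ends_linearTree_castSucc (k + 1) i v.succ)
  have h2 : (linearTree (k + 1) i).ends (Sum.inl (Fin.last k).succ, true) =
      Sum.inl (Fin.last (k + 2)) := ends_linearTree_last (k + 1) i
  have h3 : (linearTree (k + 1) i).ends (Sum.inl (0 : Fin (k + 2)), false) =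
      Sum.inl (0 : Fin (k + 3)) := rfl
  have h4 (v : Fin (k + 1)) : (linearTree (k + 1) i).ends (Sum.inl v.succ, false) =
      Sum.inr (v, (2 : Fin 3)) := rfl
  have e0 := edgeFactor_leg_inner (σ := (Fin.cons s σ : Fin (k + 1) → Equiv.Perm (Fin 3)))
    h3 h0 (j := i 0) (a := s 0) rfl rfl
  have e1 (v : Fin k) := edgeFactor_inner_inner
    (σ := (Fin.cons s σ : Fin (k + 1) → Equiv.Perm (Fin 3)))
    (h4 v.castSucc) (h1 v) (hs v.castSucc) (b := σ v 0) rfl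
  have e2 := edgeFactor_inner_leg (σ := (Fin.cons s σ : Fin (k + 1) → Equiv.Perm (Fin 3)))
    (h4 (Fin.last k)) h2 (j := i (Fin.last k).succ.succ) rfl (hs (Fin.last k))
  rw [e0, e2]
  simp only [e1]

/-- The tensor `c` is inverse to `κ`, so a strut glued to the root of a caterpillar changes nothing:
the linear tree is `c` with `branch` applied to its second factor. -/
lemma W_linearTree (k : ℕ) (i : Fin (k + 2) → Fin n) :
    (linearTree k i).W = treeValue k fun j a => place (i j) (gen a) := by
  cases k with
  | zero =>
    have h0 : (linearTree 0 i).ends (Sum.inl (0 : Fin 1), true) = Sum.inl (1 : Fin 2) :=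
      ends_linearTree_last 0 i
    have h0' : (linearTree 0 i).ends (Sum.inl (0 : Fin 1), false) = Sum.inl (0 : Fin 2) := rfl
    have h1 (σ : Fin 0 → Equiv.Perm (Fin 3)) :
        (linearTree 0 i).edgeFactor σ (Sum.inl (0 : Fin 1)) = casimir (i 0) (i 1) :=
      edgeFactor_leg_leg h0' h0 rfl rfl
    rw [W_linearTree_eq_sum, Fintype.sum_unique, Fin.prod_univ_succ, h1]
    simp [casimir, treeValue, branch, Fin.tail, gen]
  | succ k =>
    have hW : (linearTree (k + 1) i).W = ∑ s : Equiv.Perm (Fin 3),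
        ((Equiv.Perm.sign s : ℤ) : ℚ) • (place (i 0) (gen (s 0)) * place (i 1) (gen (s 1)) *
          branch k (fun j a => place (i j.succ.succ) (gen a)) (s 2)) := by
      simp only [branch_eq_sum, Finset.mul_sum, Finset.smul_sum, W_linearTree_eq_sum]
      rw [← (Fin.consEquiv fun _ => Equiv.Perm (Fin 3)).sum_comp, Fintype.sum_prod_type]
      refine Finset.sum_congr rfl fun s _ => Finset.sum_congr rfl fun σ _ => ?_
      change (∏ v, ((Equiv.Perm.sign ((Fin.cons s σ : Fin (k + 1) → Equiv.Perm (Fin 3)) v) : ℤ) :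
        ℚ)) • ((∏ x : Fin (k + 2), (linearTree (k + 1) i).edgeFactor
        (Fin.cons s σ : Fin (k + 1) → Equiv.Perm (Fin 3)) (Sum.inl x)) *
        ∏ v : Fin (k + 1), place (i v.castSucc.succ)
          (gen ((Fin.cons s σ : Fin (k + 1) → Equiv.Perm (Fin 3)) v 1))) = _
      rw [prod_spine, Fin.prod_univ_succ, Fin.prod_univ_succ, mul_smul_comm, smul_smul]
      simp only [Fin.cons_zero, Fin.cons_succ, Fin.castSucc_zero, Fin.succ_zero_eq_one,
        ← Fin.succ_castSucc]
      congr 1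
      ring
    rw [hW, sum_perm_three fun x y z => place (i 0) (gen x) * place (i 1) (gen y) *
          branch k (fun j a => place (i j.succ.succ) (gen a)) z]
    have ht : Fin.tail (Fin.tail fun (j : Fin (k + 1 + 2)) (a : Fin 3) => place (i j) (gen a)) =
      fun j a => place (i j.succ.succ) (gen a) := rfl
    simp only [treeValue, branch, ht, Algebra.smul_def]
    generalize branch k (fun j a => place (i j.succ.succ) (gen a)) = B
    -- The `½` in `c` cancels `κ(h,h) = 2`, which `branch` carries in its `h`-component.
    have h2 : algebraMap ℚ (SymTensorPower n) (1 / 2) * 2 = 1 := by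
      rw [← map_ofNat (algebraMap ℚ (SymTensorPower n)) 2, ← map_mul]; norm_num
    generalize algebraMap ℚ (SymTensorPower n) (1 / 2) = c at h2
    simp only [Fin.tail, Fin.succ_zero_eq_one, Matrix.cons_val]
    linear_combination (-(place (i 0) (gen 0)) * (place (i 1) (gen 1) * B 2 -
      place (i 1) (gen 2) * B 1)) * h2

end JacobiDiagram

namespace JacobiDiagram

/-! ### Isomorphisms and disjoint unions -/

/-- The identity of a Jacobi diagram. -/
def Iso.refl (D : JacobiDiagram n) : D.Iso D where
  onU := Equiv.refl _
  onV := Equiv.refl _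
  onE := Equiv.refl _
  rot _ := 0
  flip _ := false
  label_onU _ := rfl
  ends_onE x s := by
    rw [Bool.false_xor, Equiv.refl_apply]
    rcases D.ends (x, s) with u | ⟨v, i⟩ <;> simp

/-- The inverse of an isomorphism of Jacobi diagrams. -/
def Iso.symm {D D' : JacobiDiagram n} (φ : D.Iso D') : D'.Iso D where
  onU := φ.onU.symm
  onV := φ.onV.symm
  onE := φ.onE.symm
  rot v := -φ.rot (φ.onV.symm v)
  flip x := φ.flip (φ.onE.symm x)
  label_onU u := by simpa using (φ.label_onU (φ.onU.symm u)).symm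
  ends_onE x s := by
    have := φ.ends_onE (φ.onE.symm x) (xor (φ.flip (φ.onE.symm x)) s)
    rw [← Bool.xor_assoc, Bool.xor_self, Bool.false_xor, Equiv.apply_symm_apply] at this
    rw [this]
    rcases D.ends (φ.onE.symm x, xor (φ.flip (φ.onE.symm x)) s) with u | ⟨v, i⟩ <;> simp

/-- The composition of two isomorphisms of Jacobi diagrams. -/
def Iso.trans {D D' D'' : JacobiDiagram n} (φ : D.Iso D') (ψ : D'.Iso D'') : D.Iso D'' where
  onU := φ.onU.trans ψ.onU
  onV := φ.onV.trans ψ.onV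
  onE := φ.onE.trans ψ.onE
  rot v := φ.rot v + ψ.rot (φ.onV v)
  flip x := xor (ψ.flip (φ.onE x)) (φ.flip x)
  label_onU u := by simp [ψ.label_onU, φ.label_onU]
  ends_onE x s := by
    rw [Bool.xor_assoc, Equiv.trans_apply, ψ.ends_onE, φ.ends_onE]
    rcases D.ends (x, s) with u | ⟨v, i⟩ <;> simp [add_assoc]

lemma casimir_comm (i j : Fin n) : casimir i j = casimir j i := by
  rw [casimir, casimir, mul_comm (place i h), mul_comm (place i f), mul_comm (place i e)]
  abel

lemma sign_addRight_fin_three (r : Fin 3) : Equiv.Perm.sign (Equiv.addRight r) = 1 := by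
  fin_cases r <;> decide

/-- A rotation of the half-edges at a vertex is absorbed by composing the permutation there with the
same rotation; a reversed edge is harmless since `c` and `κ` are symmetric. -/
lemma Iso.edgeFactor_eq {D D' : JacobiDiagram n} (φ : D.Iso D')
    (σ : D'.V → Equiv.Perm (Fin 3)) (x : D.E) :
    D.edgeFactor (fun v => σ (φ.onV v) * Equiv.addRight (φ.rot v)) x =
      D'.edgeFactor σ (φ.onE x) := by
  -- With this choice of side the two flips cancel, and the ends of the image edge are listed in the
  -- order used by `edgeFactor`.
  have h0 := φ.ends_onE x (xor (φ.flip x) false)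
  have h1 := φ.ends_onE x (xor (φ.flip x) true)
  rw [← Bool.xor_assoc, Bool.xor_self, Bool.false_xor] at h0 h1
  cases hf : φ.flip x <;> rcases h2 : D.ends (x, false) with u | ⟨v, i⟩ <;>
    rcases h3 : D.ends (x, true) with u' | ⟨v', i'⟩ <;>
    simp only [hf, Bool.false_xor, Bool.true_xor, Bool.not_false, Bool.not_true, h2, h3,
      Sum.map_inl, Sum.map_inr] at h0 h1 <;>
    simp [edgeFactor, h0, h1, h2, h3, φ.label_onU]
  · exact casimir_comm _ _
  · rw [kappa_comm]

/-- Rotations of three half-edges are even, so the change of variables in the state sum preserves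
the signs. -/
theorem Iso.W_eq {D D' : JacobiDiagram n} (φ : D.Iso D') : D.W = D'.W := by
  classical
  rw [W_eq_sum, W_eq_sum]
  refine (Fintype.sum_equiv ((Equiv.arrowCongr φ.onV.symm (Equiv.refl _)).trans
    (Equiv.piCongrRight fun v => Equiv.mulRight (Equiv.addRight (φ.rot v)))) _ _
      fun σ => ?_).symm
  have hσ : ((Equiv.arrowCongr φ.onV.symm (Equiv.refl _)).trans
    (Equiv.piCongrRight fun v => Equiv.mulRight (Equiv.addRight (φ.rot v)))) σ =
      fun v => σ (φ.onV v) * Equiv.addRight (φ.rot v) := rfl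
  rw [hσ]
  congr 1
  · refine (Fintype.prod_equiv φ.onV _ _ fun v => ?_).symm
    simp [sign_addRight_fin_three]
  · exact (Fintype.prod_equiv φ.onE _ _ fun x => φ.edgeFactor_eq σ x).symm

lemma edgeFactor_disjUnion {ι : Type} [Fintype ι] (D : ι → JacobiDiagram n)
    (σ : (disjUnion D).V → Equiv.Perm (Fin 3)) (i : ι) (x : (D i).E) :
    (disjUnion D).edgeFactor σ ⟨i, x⟩ = (D i).edgeFactor (fun v => σ ⟨i, v⟩) x := by
  rcases h0 : (D i).ends (x, false) with u | ⟨v, j⟩ <;>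
    rcases h1 : (D i).ends (x, true) with u' | ⟨v', j'⟩ <;>
    simp [edgeFactor, disjUnion, h0, h1]

lemma prod_smul_prod {ι A : Type*} [CommRing A] [Algebra ℚ A] (s : Finset ι) (c : ι → ℚ)
    (a : ι → A) : ∏ i ∈ s, c i • a i = (∏ i ∈ s, c i) • ∏ i ∈ s, a i := by
  simp only [Algebra.smul_def, Finset.prod_mul_distrib, map_prod]

/-- A state on the union is a family of states on the components, so the state sum is an expanded
product of sums. -/
theorem W_disjUnion {ι : Type} [Fintype ι] (D : ι → JacobiDiagram n) :
    (disjUnion D).W = ∏ i, (D i).W := by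
  classical
  have h1 (σ : (disjUnion D).V → Equiv.Perm (Fin 3)) : ∏ x, (disjUnion D).edgeFactor σ x =
      ∏ i, ∏ x, (D i).edgeFactor (fun v => σ ⟨i, v⟩) x :=
    (Fintype.prod_sigma (ι := ι) (α := fun i => (D i).E) _).trans
      (Finset.prod_congr rfl fun i _ => Finset.prod_congr rfl fun x _ =>
        edgeFactor_disjUnion D σ i x)
  have h2 (σ : (disjUnion D).V → Equiv.Perm (Fin 3)) :
      ∏ v, ((Equiv.Perm.sign (σ v) : ℤ) : ℚ) =
        ∏ i, ∏ v : (D i).V, ((Equiv.Perm.sign (σ ⟨i, v⟩) : ℤ) : ℚ) :=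
    Fintype.prod_sigma (ι := ι) (α := fun i => (D i).V) _
  let F : (∀ i, (D i).V → Equiv.Perm (Fin 3)) → SymTensorPower n := fun τ =>
    (∏ i, ∏ v : (D i).V, ((Equiv.Perm.sign (τ i v) : ℤ) : ℚ)) •
      ∏ i, ∏ x, (D i).edgeFactor (τ i) x
  have h3 : ∏ i, (D i).W = ∑ τ, F τ := by
    simp_rw [W_eq_sum]
    rw [Finset.prod_univ_sum, Fintype.piFinset_univ]
    exact Finset.sum_congr rfl fun τ _ => 
      prod_smul_prod _ _ _
  rw [h3, W_eq_sum]
  let e : ((disjUnion D).V → Equiv.Perm (Fin 3)) ≃ (∀ i, (D i).V → Equiv.Perm (Fin 3)) :=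
    Equiv.piCurry (α := ι) (β := fun i => (D i).V) fun _ _ => Equiv.Perm (Fin 3)
  refine Fintype.sum_equiv e _ F fun σ => ?_
  rw [h1 σ, h2 σ]
  rfl

end JacobiDiagram

/-! ### Naturality -/

lemma map_branch {A B : Type*} [CommRing A] [CommRing B] (φ : A →+* B) (k : ℕ)
    (p : Fin (k + 1) → Fin 3 → A) (a : Fin 3) :
    φ (branch k p a) = branch k (fun j b => φ (p j b)) a := by
  induction k generalizing a with
  | zero => rfl
  | succ k ih =>
    have ht : Fin.tail (fun (j : Fin (k + 2)) b => φ (p j b)) =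
      fun j b => φ (Fin.tail p j b) := rfl
    have h2 : φ 2 = 2 := map_ofNat φ 2
    fin_cases a <;> simp [branch, ih, ht, h2]

/-- This lets the tree formula be evaluated in the dual numbers, for invariance, and in `ℚ[X]`, for
leading words. -/
lemma map_treeValue {A B : Type*} [CommRing A] [CommRing B] [Algebra ℚ A] [Algebra ℚ B]
    (φ : A →ₐ[ℚ] B) (k : ℕ) (p : Fin (k + 2) → Fin 3 → A) :
    φ (treeValue k p) = treeValue k fun j b => φ (p j b) := by
  have h (a : Fin 3) := map_branch (φ : A →+* B) k (Fin.tail p) a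
  have ht : Fin.tail (fun (j : Fin (k + 2)) b => φ (p j b)) =
      fun j b => (φ : A →+* B) (Fin.tail p j b) := rfl
  simp only [treeValue, map_add, map_smul, map_mul, ht, ← h]
  rfl

instance : IsScalarTower ℚ (SymTensorPower n) (SymTensorPower n) :=
  IsScalarTower.right (R := ℚ) (A := SymTensorPower n)

instance : SMulCommClass ℚ (SymTensorPower n) (SymTensorPower n) :=
  Algebra.to_smulCommClass (R := ℚ) (A := SymTensorPower n)

/-! ### The image of the tensors of degree one -/

/-- The span of the products of one element of `sl₂` at each position in `s`. -/
def multilinearPart (s : Finset (Fin n)) : Submodule ℚ (SymTensorPower n) :=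
  Submodule.span ℚ (Set.range fun v : Fin n → sl2 => ∏ j ∈ s, place j (v j))

lemma place_mem_multilinearPart (j : Fin n) (x : sl2) : place j x ∈ multilinearPart {j} :=
  Submodule.subset_span ⟨fun _ => x, by simp⟩

lemma mul_mem_multilinearPart {s t : Finset (Fin n)} (hst : Disjoint s t)
    {x y : SymTensorPower n} (hx : x ∈ multilinearPart s) (hy : y ∈ multilinearPart t) :
    x * y ∈ multilinearPart (s ∪ t) := by
  have h : multilinearPart s * multilinearPart t ≤ multilinearPart (s ∪ t) := by
    rw [multilinearPart, multilinearPart, Submodule.span_mul_span, Submodule.span_le]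
    rintro _ ⟨_, ⟨v, rfl⟩, _, ⟨w, rfl⟩, rfl⟩
    refine Submodule.subset_span ⟨fun j => if j ∈ s then v j else w j, ?_⟩
    simp only
    rw [Finset.prod_union hst]
    refine congrArg₂ (· * ·) (Finset.prod_congr rfl fun j hj => by rw [if_pos hj])
      (Finset.prod_congr rfl fun j hj => by rw [if_neg (Finset.disjoint_right.1 hst hj)])
  exact h (Submodule.mul_mem_mul hx hy)

lemma one_mem_multilinearPart : (1 : SymTensorPower n) ∈ multilinearPart ∅ :=
  Submodule.subset_span ⟨0, by simp⟩

lemma prod_mem_multilinearPart {κ : Type*} (s : Finset κ) (x : κ → SymTensorPower n)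
    (t : κ → Finset (Fin n)) (hx : ∀ i ∈ s, x i ∈ multilinearPart (t i))
    (ht : (s : Set κ).PairwiseDisjoint t) :
    ∏ i ∈ s, x i ∈ multilinearPart (s.biUnion t) := by
  classical
  induction s using Finset.induction_on with
  | empty => simpa using one_mem_multilinearPart
  | insert i s hi ih =>
    rw [Finset.prod_insert hi, Finset.biUnion_insert]
    refine mul_mem_multilinearPart ?_ (hx i (by simp))
      (ih (fun j hj => hx j (by simp [hj])) (ht.subset (by simp)))
    rw [Finset.disjoint_biUnion_right]
    intro j hj
    exact ht (by simp) (by simp [hj]) (fun h => hi (h ▸ hj))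

lemma multilinearPart_univ_le : multilinearPart (Finset.univ : Finset (Fin n)) ≤
    LinearMap.range (incl n) := by
  rw [multilinearPart, Submodule.span_le]
  rintro _ ⟨v, rfl⟩
  exact ⟨_, incl_tprod v⟩

lemma branch_mem_multilinearPart (k : ℕ) (l : Fin (k + 1) → Fin n) (hl : Function.Injective l)
    (a : Fin 3) : branch k (fun j b => place (l j) (gen b)) a ∈
      multilinearPart (Finset.univ.image l) := by
  induction k generalizing a with
  | zero =>
    have : (Finset.univ : Finset (Fin (0 + 1))).image l = {l 0} := by
      simp
    rw [this]
    exact place_mem_multilinearPart _ _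
  | succ k ih =>
    have hl' : Function.Injective (Fin.tail l) := fun x y hxy => Fin.succ_injective _ (hl hxy)
    have key (x : sl2) (b : Fin 3) : place (l 0) x *
        branch k (fun j b => place (Fin.tail l j) (gen b)) b ∈
          multilinearPart (Finset.univ.image l) := by
      have himg : Finset.univ.image l = {l 0} ∪ Finset.univ.image (Fin.tail l) := by
        ext i
        simp [Fin.exists_fin_succ, Fin.tail, eq_comm]
      rw [himg]
      refine mul_mem_multilinearPart ?_ (place_mem_multilinearPart _ _) (ih _ hl' b)
      simp only [Finset.disjoint_singleton_left, Finset.mem_image, not_exists]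
      rintro j ⟨-, hj⟩
      exact Fin.succ_ne_zero j (hl hj)
    have ht : Fin.tail (fun (j : Fin (k + 2)) (b : Fin 3) => place (l j) (gen b)) =
      fun j b => place (Fin.tail l j) (gen b) := rfl
    fin_cases a
    · simp only [branch, ht, two_mul]
      exact Submodule.add_mem _ (Submodule.sub_mem _ (key _ _) (key _ _))
        (Submodule.sub_mem _ (key _ _) (key _ _))
    · exact Submodule.sub_mem _ (key _ _) (key _ _)
    · exact Submodule.sub_mem _ (key _ _) (key _ _)

/-- Each leg contributes one element of `sl₂`, and the labels are distinct; hence the values of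
Riordan trees lie in the range of `incl`. -/
lemma treeValue_mem_multilinearPart (k : ℕ) (l : Fin (k + 2) → Fin n)
    (hl : Function.Injective l) : treeValue k (fun j b => place (l j) (gen b)) ∈
      multilinearPart (Finset.univ.image l) := by
  have hl' : Function.Injective (Fin.tail l) := fun x y hxy => Fin.succ_injective _ (hl hxy)
  have key (x : sl2) (b : Fin 3) : place (l 0) x *
      branch k (fun j b => place (Fin.tail l j) (gen b)) b ∈
        multilinearPart (Finset.univ.image l) := by
    have himg : Finset.univ.image l = {l 0} ∪ Finset.univ.image (Fin.tail l) := by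
      ext i
      simp [Fin.exists_fin_succ, Fin.tail, eq_comm]
    rw [himg]
    refine mul_mem_multilinearPart ?_ (place_mem_multilinearPart _ _)
      (branch_mem_multilinearPart k _ hl' b)
    simp only [Finset.disjoint_singleton_left, Finset.mem_image, not_exists]
    rintro j ⟨-, hj⟩
    exact Fin.succ_ne_zero j (hl hj)
  exact Submodule.add_mem _ (Submodule.add_mem _ (Submodule.smul_mem _ _ (key _ _)) (key _ _))
    (key _ _)

/-! ### Invariance, by means of dual numbers -/

section dualNumber

open TrivSqZeroExt

/-- The first order deformation of a family `p`, indexed by the generators, in the direction of the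
adjoint action of the generator `y`. -/
def deform {A : Type*} [CommRing A] [Algebra ℚ A] (y : Fin 3) (p : Fin 3 → A) (a : Fin 3) :
    DualNumber A :=
  inl (p a) + inr (∑ b, algebraMap ℚ A (adMatrix y b a) * p b)

/-- Equivariance of `b` and `κ`: deforming all legs deforms the output. Since `ε² = 0`,
multiplication of dual numbers already contains the Leibniz rule, and each vertex is a check on
generators. -/
lemma branch_deform {A : Type*} [CommRing A] [Algebra ℚ A] (y : Fin 3) (k : ℕ)
    (p : Fin (k + 1) → Fin 3 → A) (a : Fin 3) :
    branch k (fun j => deform y (p j)) a = deform y (branch k p) a := by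
  induction k generalizing a with
  | zero => rfl
  | succ k ih =>
    have ht : Fin.tail (fun (j : Fin (k + 2)) => deform y (p j)) =
      fun j => deform y (Fin.tail p j) := rfl
    simp only [branch, ht, ih]
    generalize branch k (Fin.tail p) = B
    have h2 : (2 : DualNumber A) = inl 2 := rfl
    have h2' : algebraMap ℚ A 2 = 2 := map_ofNat _ 2
    fin_cases y <;> fin_cases a <;> ext <;>
      simp [deform, adMatrix, Fin.sum_univ_three, h2, h2'] <;> ring

/-- Invariance of `c`: after `branch_deform` the coefficient of `ε` cancels. -/
lemma treeValue_deform {A : Type*} [CommRing A] [Algebra ℚ A] (y : Fin 3) (k : ℕ)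
    (p : Fin (k + 2) → Fin 3 → A) :
    treeValue k (fun j => deform y (p j)) = inl (treeValue k p) := by
  have ht : Fin.tail (fun (j : Fin (k + 2)) => deform y (p j)) =
      fun j => deform y (Fin.tail p j) := rfl
  simp only [treeValue, ht, branch_deform]
  generalize branch k (Fin.tail p) = B
  have h2' : algebraMap ℚ A 2 = 2 := map_ofNat _ 2
  have h2 : algebraMap ℚ A 2⁻¹ * 2 = 1 := by
    rw [← h2', ← map_mul]; norm_num
  ext
  · simp [deform]
  · fin_cases y <;>
      simp [deform, adMatrix, Fin.sum_univ_three, Algebra.smul_def (R := ℚ) (A := A), h2']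
    · ring
    · linear_combination (-(p 0 0 * B 1) - p 0 1 * B 0) * h2
    · linear_combination (p 0 0 * B 2 + p 0 2 * B 0) * h2

/-- The algebra map `1 + ε x` on `S(sl₂)^{⊗n}`, where `x` is the generator `y`. -/
def deformHom (n : ℕ) (y : Fin 3) : SymTensorPower n →ₐ[ℚ] DualNumber (SymTensorPower n) :=
  placeLift (A := DualNumber (SymTensorPower n)) fun j =>
    (inlAlgHom ℚ (SymTensorPower n) (SymTensorPower n)).toLinearMap ∘ₗ place j +
      (inrHom (SymTensorPower n) (SymTensorPower n)).restrictScalars ℚ ∘ₗ place j ∘ₗ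
        (LieAlgebra.ad ℚ sl2 (gen y) : sl2 →ₗ[ℚ] sl2)

lemma deformHom_place (y : Fin 3) (j : Fin n) (x : sl2) :
    deformHom n y (place j x) = inl (place j x) + inr (place j ⁅gen y, x⁆) := by
  rw [deformHom, placeLift_place]
  rfl

lemma deformHom_place_gen (y : Fin 3) (j : Fin n) (a : Fin 3) :
    deformHom n y (place j (gen a)) = deform y (fun b => place j (gen b)) a := by
  rw [deformHom_place, lie_gen, deform, map_sum]
  refine congrArg _ (congrArg _ (Finset.sum_congr rfl fun b _ => ?_))
  rw [map_smul]
  exact Algebra.smul_def (R := ℚ) (A := SymTensorPower n) _ _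

lemma prod_inl {A κ : Type*} [CommRing A] (s : Finset κ) (a : κ → A) :
    ∏ j ∈ s, (inl (a j) : DualNumber A) = inl (∏ j ∈ s, a j) :=
  (map_prod (inlHom A A) a s).symm

lemma prod_inl_add_inr {A κ : Type*} [CommRing A] [DecidableEq κ] (s : Finset κ) (a b : κ → A) :
    ∏ j ∈ s, (inl (a j) + inr (b j) : DualNumber A) =
      inl (∏ j ∈ s, a j) + inr (∑ i ∈ s, ∏ j ∈ s, if j = i then b j else a j) := by
  induction s using Finset.induction_on with
  | empty => simp
  | insert i s hi ih =>
    have h1 : ∀ x ∈ s, ∏ j ∈ insert i s, (if j = x then b j else a j) =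
        a i * ∏ j ∈ s, if j = x then b j else a j := fun x hx => by
      rw [Finset.prod_insert hi, if_neg (ne_of_mem_of_not_mem hx hi).symm]
    have h2 : ∏ j ∈ s, (if j = i then b j else a j) = ∏ j ∈ s, a j :=
      Finset.prod_congr rfl fun j hj => if_neg (ne_of_mem_of_not_mem hj hi)
    rw [Finset.prod_insert hi, ih, Finset.sum_insert hi, Finset.sum_congr rfl h1,
      Finset.prod_insert hi, Finset.prod_insert hi, if_pos rfl, h2, ← Finset.mul_sum]
    ext
    · simp
    · simp; ring

/-- The action on tensors is the coefficient of `ε` in an algebra map, so invariance can be tested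
factor by factor on a product. -/
lemma deformHom_incl (y : Fin 3) (t : TensorPower n) :
    deformHom n y (incl n t) = inl (incl n t) + inr (incl n (act n (gen y) t)) := by
  have key : (deformHom n y).toLinearMap ∘ₗ incl n =
      (inlAlgHom ℚ (SymTensorPower n) (SymTensorPower n)).toLinearMap ∘ₗ incl n +
      (inrHom (SymTensorPower n) (SymTensorPower n)).restrictScalars ℚ ∘ₗ incl n ∘ₗ
        act n (gen y) := by
    refine PiTensorProduct.ext (MultilinearMap.ext fun v => ?_)
    have h1 : act n (gen y) (PiTensorProduct.tprod ℚ v) =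
        ∑ i, PiTensorProduct.tprod ℚ fun j => if j = i then ⁅gen y, v j⁆ else v j := by
      rw [act, LinearMap.sum_apply]
      refine Finset.sum_congr rfl fun i _ => ?_
      rw [PiTensorProduct.map_tprod]
      congr 1
      funext j
      by_cases hj : j = i
      · subst hj; simp
      · simp [hj]
    have h2 : (deformHom n y) (incl n (PiTensorProduct.tprod ℚ v)) =
        inl (incl n (PiTensorProduct.tprod ℚ v)) +
          inr (incl n (act n (gen y) (PiTensorProduct.tprod ℚ v))) := by
      rw [h1, map_sum, incl_tprod, map_prod]
      simp only [deformHom_place, incl_tprod]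
      rw [prod_inl_add_inr]
      congr 2
      refine Finset.sum_congr rfl fun i _ => Finset.prod_congr rfl fun j _ => ?_
      split_ifs <;> rfl
    exact h2
  exact LinearMap.congr_fun key t

end dualNumber

lemma mem_map_incl_Inv {x : SymTensorPower n} (hx : x ∈ LinearMap.range (incl n))
    (h : ∀ y, deformHom n y x = TrivSqZeroExt.inl x) : x ∈ (Inv n).map (incl n) := by
  obtain ⟨t, rfl⟩ := hx
  have key (y : Fin 3) : act n (gen y) t = 0 := by
    have h1 := h y
    rw [deformHom_incl] at h1
    have h2 := congrArg TrivSqZeroExt.snd h1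
    refine incl_injective ?_
    simpa using h2
  exact ⟨t, ⟨⟨key 0, key 1⟩, key 2⟩, rfl⟩

/-! ### The value of the weight system on the tree of a partition -/

/-- The value of the weight system on the union of the ordered linear trees on the parts of `P`. -/
def riordanValue (P : Finpartition (Finset.univ : Finset (Fin n))) (hP : IsRiordanPartition P) :
    SymTensorPower n :=
  (JacobiDiagram.disjUnion fun p : P.parts =>
      orderedLinearTree p.1 (hP.two_le_card p.1 p.2)).W

/-- The increasing enumeration of a part of a Riordan partition. -/
def enum (p : Finset (Fin n)) (hp : 2 ≤ p.card) : Fin (p.card - 2 + 2) ↪o Fin n :=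
  p.orderEmbOfFin (show p.card = p.card - 2 + 2 by omega)

lemma image_enum (p : Finset (Fin n)) (hp : 2 ≤ p.card) :
    Finset.univ.image (enum p hp) = p := by
  apply Finset.coe_injective
  simp [enum]

lemma riordanValue_eq (P : Finpartition (Finset.univ : Finset (Fin n)))
    (hP : IsRiordanPartition P) : riordanValue P hP = ∏ p : P.parts,
      treeValue (p.1.card - 2) fun j a => place (enum p.1 (hP.two_le_card p.1 p.2) j) (gen a) := by
  rw [riordanValue, JacobiDiagram.W_disjUnion]
  exact Finset.prod_congr rfl fun p _ => JacobiDiagram.W_linearTree _ _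

lemma riordanValue_mem (P : Finpartition (Finset.univ : Finset (Fin n)))
    (hP : IsRiordanPartition P) : riordanValue P hP ∈ (Inv n).map (incl n) := by
  refine mem_map_incl_Inv ?_ fun y => ?_
  · rw [riordanValue_eq]
    apply multilinearPart_univ_le
    have h := prod_mem_multilinearPart (Finset.univ : Finset P.parts)
      (fun p => treeValue (p.1.card - 2) fun j a =>
        place (enum p.1 (hP.two_le_card p.1 p.2) j) (gen a)) (fun p => p.1) (fun p _ => by
          have := treeValue_mem_multilinearPart (p.1.card - 2)
            (enum p.1 (hP.two_le_card p.1 p.2)) (enum p.1 _).injective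
          rwa [image_enum] at this)
      (fun p _ q _ hpq => P.disjoint p.2 q.2 fun h => hpq (Subtype.ext h))
    convert h
    symm
    rw [Finset.eq_univ_iff_forall]
    intro i
    obtain ⟨p, hp, hi⟩ := P.exists_mem (Finset.mem_univ i)
    exact Finset.mem_biUnion.2 ⟨⟨p, hp⟩, Finset.mem_univ _, hi⟩
  · rw [riordanValue_eq, map_prod]
    refine (Finset.prod_congr rfl fun p _ => ?_).trans
      (prod_inl _ _)
    refine (map_treeValue (A := SymTensorPower n) (B := DualNumber (SymTensorPower n))
      (deformHom n y) _ _).trans ?_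
    simp only [deformHom_place_gen]
    exact treeValue_deform _ _ _

/-! ### Leading words -/

open Polynomial

/-- The rank of a letter in the order `e < h < f`. -/
def rank : Fin 3 → Fin 3 := ![1, 0, 2]

lemma rank_injective : Function.Injective rank := by decide

/-- The algebra map to `ℚ[X]` that reads a word in `h`, `e`, `f` as a number in base three. -/
def code (n : ℕ) : SymTensorPower n →ₐ[ℚ] ℚ[X] :=
  placeLift fun j => genBasis.constr ℚ fun a => X ^ ((rank a : ℕ) * 3 ^ (j.rev : ℕ))

lemma code_place (j : Fin n) (a : Fin 3) :
    code n (place j (gen a)) = X ^ ((rank a : ℕ) * 3 ^ (j.rev : ℕ)) := by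
  rw [code, placeLift_place, ← genBasis_apply, Module.Basis.constr_basis]

/-- A geometric series of ratio at most `1/3`. Applied to a tail, it shows that one unit of rank in
the first letter outweighs all later letters, whose ranks are at most 2. -/
lemma two_mul_sum_lt {k : ℕ} (w : Fin (k + 1) → ℕ) (h0 : ∀ j, 0 < w j)
    (hw : ∀ i j, i < j → 3 * w j ≤ w i) : 2 * ∑ j, w j < 3 * w 0 := by
  induction k with
  | zero =>
    have := h0 0
    rw [Fin.sum_univ_one]
    omega
  | succ k ih =>
    have h := ih (Fin.tail w) (fun j => h0 _) fun i j hij => hw _ _ (Fin.succ_lt_succ_iff.2 hij)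
    have h1 : 3 * Fin.tail w 0 ≤ w 0 := hw 0 (Fin.succ 0) (Fin.succ_pos 0)
    have h2 : ∑ j, w j = w 0 + ∑ j, Fin.tail w j := Fin.sum_univ_succ _
    omega

/-- With `e` fed to the root, the leading word is `h ⋯ h e`: of the two terms of the recursion, the
one with `h` on the first leg wins over the one with `e`. For the other inputs the bound by the word
`f ⋯ f` suffices. The weights need only drop by a factor of three, as the legs of a part may occupy
non-consecutive positions. -/
lemma natDegree_branch {k : ℕ} (w : Fin (k + 1) → ℕ) (h0 : ∀ j, 0 < w j)
    (hw : ∀ i j, i < j → 3 * w j ≤ w i) :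
    (∀ a, (branch k (fun j b => (X : ℚ[X]) ^ ((rank b : ℕ) * w j)) a).natDegree ≤ 2 * ∑ j, w j) ∧
    (branch k (fun j b => (X : ℚ[X]) ^ ((rank b : ℕ) * w j)) 1).Monic ∧
    (branch k (fun j b => (X : ℚ[X]) ^ ((rank b : ℕ) * w j)) 1).natDegree =
      ∑ j : Fin k, w j.castSucc := by
  induction k with
  | zero =>
    refine ⟨fun a => ?_, ?_, ?_⟩
    · fin_cases a <;> simp [branch, rank]
      omega
    · simp [branch, rank]
    · simp [branch, rank]
  | succ k ih =>
    have h0' : ∀ j, 0 < Fin.tail w j := fun j => h0 _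
    have hw' : ∀ i j, i < j → 3 * Fin.tail w j ≤ Fin.tail w i :=
      fun i j hij => hw _ _ (Fin.succ_lt_succ_iff.2 hij)
    obtain ⟨h1, h2, h3⟩ := ih (Fin.tail w) h0' hw'
    have ht : Fin.tail (fun (j : Fin (k + 2)) b => (X : ℚ[X]) ^ ((rank b : ℕ) * w j)) =
      fun j b => X ^ ((rank b : ℕ) * Fin.tail w j) := rfl
    have hsum : ∑ j, w j = w 0 + ∑ j, Fin.tail w j := Fin.sum_univ_succ _
    have hlt := two_mul_sum_lt (Fin.tail w) h0' hw'
    have hle : 3 * Fin.tail w 0 ≤ w 0 := hw 0 (Fin.succ 0) (Fin.succ_pos 0)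
    simp only [branch, ht]
    generalize branch k (fun j b => (X : ℚ[X]) ^ ((rank b : ℕ) * Fin.tail w j)) = B at h1 h2 h3 ⊢
    have hmul (b c : Fin 3) : (X ^ ((rank b : ℕ) * w 0) * B c : ℚ[X]).natDegree ≤
        2 * ∑ j, w j := by
      refine natDegree_mul_le.trans ?_
      rw [natDegree_X_pow]
      have := h1 c
      have hr : (rank b : ℕ) ≤ 2 := by omega
      have := Nat.mul_le_mul_right (w 0) hr
      omega
    have hm : (X ^ ((rank 0 : ℕ) * w 0) * B 1 : ℚ[X]).Monic := (monic_X_pow _).mul h2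
    have hd : (X ^ ((rank 0 : ℕ) * w 0) * B 1 : ℚ[X]).natDegree =
        ∑ j : Fin (k + 1), w j.castSucc := by
      rw [(monic_X_pow _).natDegree_mul h2, natDegree_X_pow, h3, Fin.sum_univ_succ]
      simp [rank, Fin.tail]
    have hl : (X ^ ((rank 1 : ℕ) * w 0) * B 0 : ℚ[X]).natDegree <
        (X ^ ((rank 0 : ℕ) * w 0) * B 1 : ℚ[X]).natDegree := by
      have e1 : (X ^ ((rank 1 : ℕ) * w 0) * B 0 : ℚ[X]) = B 0 := by simp [rank]
      rw [hd, Fin.sum_univ_succ, e1, Fin.castSucc_zero]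
      refine (h1 0).trans_lt (lt_of_lt_of_le (by omega) (Nat.le_add_right _ _))
    refine ⟨fun a => ?_, ?_, ?_⟩
    · fin_cases a
      · refine (natDegree_mul_le.trans (Nat.add_le_add (natDegree_ofNat 2).le
          (natDegree_sub_le_of_le (hmul _ _) (hmul _ _)))).trans ?_
        simp
      · exact (natDegree_sub_le_of_le (hmul _ _) (hmul _ _)).trans (by simp)
      · exact (natDegree_sub_le_of_le (hmul _ _) (hmul _ _)).trans (by simp)
    · exact hm.sub_of_left (degree_lt_degree hl)
    · exact (natDegree_sub_eq_left_of_natDegree_lt hl).trans hd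

/-- Of the three terms of `c`, the one with `f` on the first leg dominates, and it feeds `e` to the
branch; the leading word is `f h ⋯ h e`. -/
lemma natDegree_treeValue {k : ℕ} (w : Fin (k + 2) → ℕ) (h0 : ∀ j, 0 < w j)
    (hw : ∀ i j, i < j → 3 * w j ≤ w i) :
    (treeValue k (fun j b => (X : ℚ[X]) ^ ((rank b : ℕ) * w j))).Monic ∧
    (treeValue k (fun j b => (X : ℚ[X]) ^ ((rank b : ℕ) * w j))).natDegree =
      2 * w 0 + ∑ j : Fin k, w j.castSucc.succ := by
  have h0' : ∀ j, 0 < Fin.tail w j := fun j => h0 _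
  have hw' : ∀ i j, i < j → 3 * Fin.tail w j ≤ Fin.tail w i :=
    fun i j hij => hw _ _ (Fin.succ_lt_succ_iff.2 hij)
  obtain ⟨h1, h2, h3⟩ := natDegree_branch (Fin.tail w) h0' hw'
  have ht : Fin.tail (fun (j : Fin (k + 2)) b => (X : ℚ[X]) ^ ((rank b : ℕ) * w j)) =
    fun j b => X ^ ((rank b : ℕ) * Fin.tail w j) := rfl
  have hlt := two_mul_sum_lt (Fin.tail w) h0' hw'
  have hle : 3 * Fin.tail w 0 ≤ w 0 := hw 0 (Fin.succ 0) (Fin.succ_pos 0)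
  have hpos := h0 0
  simp only [treeValue, ht]
  generalize branch k (fun j b => (X : ℚ[X]) ^ ((rank b : ℕ) * Fin.tail w j)) = B at h1 h2 h3 ⊢
  have hm : (X ^ ((rank 2 : ℕ) * w 0) * B 1 : ℚ[X]).Monic := (monic_X_pow _).mul h2
  have hd : (X ^ ((rank 2 : ℕ) * w 0) * B 1 : ℚ[X]).natDegree =
      2 * w 0 + ∑ j : Fin k, w j.castSucc.succ := by
    rw [(monic_X_pow _).natDegree_mul h2, natDegree_X_pow, h3]
    rfl
  have hl : ((1 / 2 : ℚ) • (X ^ ((rank 0 : ℕ) * w 0) * B 0) +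
      X ^ ((rank 1 : ℕ) * w 0) * B 2 : ℚ[X]).natDegree <
      (X ^ ((rank 2 : ℕ) * w 0) * B 1 : ℚ[X]).natDegree := by
    have e1 : (X ^ ((rank 1 : ℕ) * w 0) * B 2 : ℚ[X]) = B 2 := by simp [rank]
    have e2 : ((1 / 2 : ℚ) • (X ^ ((rank 0 : ℕ) * w 0) * B 0) : ℚ[X]).natDegree ≤
        w 0 + 2 * ∑ j, Fin.tail w j := by
      refine (natDegree_smul_le _ _).trans (natDegree_mul_le.trans ?_)
      rw [natDegree_X_pow]
      exact Nat.add_le_add (by simp [rank]) (h1 0)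
    rw [hd, e1]
    refine (natDegree_add_le_of_le e2 (h1 2)).trans_lt ?_
    rw [max_eq_left (by omega)]
    exact lt_of_lt_of_le (by omega) (Nat.le_add_right _ _)
  have hre : (1 / 2 : ℚ) • (X ^ ((rank 0 : ℕ) * w 0) * B 0) + X ^ ((rank 2 : ℕ) * w 0) * B 1 +
      X ^ ((rank 1 : ℕ) * w 0) * B 2 = X ^ ((rank 2 : ℕ) * w 0) * B 1 +
      ((1 / 2 : ℚ) • (X ^ ((rank 0 : ℕ) * w 0) * B 0) + X ^ ((rank 1 : ℕ) * w 0) * B 2) := by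
    abel
  rw [hre]
  exact ⟨hm.add_of_left (degree_lt_degree hl),
    (natDegree_add_eq_left_of_natDegree_lt hl).trans hd⟩

/-- The letter at the position `j` of the part `p`: `f` at the first element, `e` at the last one and
`h` at the others. -/
def letter (p : Finset (Fin n)) (j : Fin n) : Fin 3 :=
  if ∀ i ∈ p, j ≤ i then 2 else if ∀ i ∈ p, i ≤ j then 1 else 0

/-- The word of a partition. -/
def word (P : Finpartition (Finset.univ : Finset (Fin n))) (j : Fin n) : Fin 3 :=
  letter (P.part j) j

lemma code_treeValue (p : Finset (Fin n)) (hp : 2 ≤ p.card) :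
    (code n (treeValue (p.card - 2) fun j a => place (enum p hp j) (gen a))).Monic ∧
    (code n (treeValue (p.card - 2) fun j a => place (enum p hp j) (gen a))).natDegree =
      ∑ j ∈ p, (rank (letter p j) : ℕ) * 3 ^ (j.rev : ℕ) := by
  have h1 : code n (treeValue (p.card - 2) fun j a => place (enum p hp j) (gen a)) =
      treeValue (p.card - 2) fun j a => X ^ ((rank a : ℕ) * 3 ^ ((enum p hp j).rev : ℕ)) := by
    refine (map_treeValue (A := SymTensorPower n) (code n) _ _).trans ?_
    simp only [code_place]
  rw [h1]
  obtain ⟨h2, h3⟩ := natDegree_treeValue (fun j => 3 ^ ((enum p hp j).rev : ℕ))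
    (fun j => by positivity) (fun i j hij => by
      have : enum p hp i < enum p hp j := (enum p hp).strictMono hij
      rw [← pow_succ']
      refine Nat.pow_le_pow_right (by norm_num) ?_
      rw [Fin.val_rev, Fin.val_rev]
      omega)
  refine ⟨h2, h3.trans ?_⟩
  have hmem (i : Fin n) : i ∈ p ↔ ∃ j, enum p hp j = i := by
    conv_lhs => rw [← image_enum p hp]
    simp
  have hsum : ∑ j ∈ p, (rank (letter p j) : ℕ) * 3 ^ (j.rev : ℕ) =
      ∑ j, (rank (letter p (enum p hp j)) : ℕ) * 3 ^ ((enum p hp j).rev : ℕ) := by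
    conv_lhs => rw [← image_enum p hp]
    rw [Finset.sum_image fun x _ y _ hxy => (enum p hp).injective hxy, image_enum]
  have hfirst : letter p (enum p hp 0) = 2 := by
    rw [letter, if_pos]
    intro i hi
    obtain ⟨j, rfl⟩ := (hmem i).1 hi
    simp
  have hnot (j : Fin (p.card - 2 + 1)) : ¬ ∀ i ∈ p, enum p hp j.succ ≤ i := by
    intro h
    have := h (enum p hp 0) ((hmem _).2 ⟨_, rfl⟩)
    simp at this
  have hlast : letter p (enum p hp (Fin.last _).succ) = 1 := by
    rw [letter, if_neg (hnot _), if_pos]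
    intro i hi
    obtain ⟨j, rfl⟩ := (hmem i).1 hi
    rw [OrderEmbedding.le_iff_le, Fin.succ_last]
    exact Fin.le_last _
  have hmid (j : Fin (p.card - 2)) : letter p (enum p hp j.castSucc.succ) = 0 := by
    rw [letter, if_neg (hnot _), if_neg]
    intro h
    have := h (enum p hp (Fin.last _)) ((hmem _).2 ⟨_, rfl⟩)
    rw [OrderEmbedding.le_iff_le, Fin.last_le_iff, ← Fin.succ_last, Fin.succ_inj] at this
    exact (Fin.castSucc_lt_last j).ne this
  rw [hsum, Fin.sum_univ_succ, Fin.sum_univ_castSucc, hfirst, hlast]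
  simp only [hmid]
  simp [rank]

lemma code_riordanValue (P : Finpartition (Finset.univ : Finset (Fin n)))
    (hP : IsRiordanPartition P) : (code n (riordanValue P hP)).Monic ∧
      (code n (riordanValue P hP)).natDegree =
        ∑ j, (rank (word P j) : ℕ) * 3 ^ (j.rev : ℕ) := by
  have h (p : P.parts) := code_treeValue p.1 (hP.two_le_card p.1 p.2)
  rw [riordanValue_eq, map_prod]
  refine ⟨monic_prod_of_monic _ _ fun p _ => (h p).1, ?_⟩
  rw [natDegree_prod_of_monic _ _ fun p _ => (h p).1, Finset.sum_congr rfl fun p _ => (h p).2]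
  have h1 : ∑ p : P.parts, ∑ j ∈ p.1, (rank (letter p.1 j) : ℕ) * 3 ^ (j.rev : ℕ) =
      ∑ p : P.parts, ∑ j ∈ p.1, (rank (word P j) : ℕ) * 3 ^ (j.rev : ℕ) :=
    Finset.sum_congr rfl fun p _ => Finset.sum_congr rfl fun j hj => by
      rw [word, P.part_eq_of_mem p.2 hj]
  rw [h1, Finset.sum_coe_sort P.parts fun p => ∑ j ∈ p, (rank (word P j) : ℕ) * 3 ^ (j.rev : ℕ),
    show ∑ p ∈ P.parts, ∑ j ∈ p, (rank (word P j) : ℕ) * 3 ^ (j.rev : ℕ) =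
      ∑ p ∈ P.parts, ∑ j ∈ id p, (rank (word P j) : ℕ) * 3 ^ (j.rev : ℕ) from rfl,
    ← Finset.sum_biUnion P.disjoint, ← Finset.sup_eq_biUnion, P.sup_parts]

lemma sum_rank_injective : Function.Injective
    fun w : Fin n → Fin 3 => ∑ j, (rank (w j) : ℕ) * 3 ^ (j.rev : ℕ) := by
  intro v w hvw
  have h (u : Fin n → Fin 3) : ∑ j, (rank (u j) : ℕ) * 3 ^ (j.rev : ℕ) =
      finFunctionFinEquiv fun j : Fin n => rank (u j.rev) := by
    rw [finFunctionFinEquiv_apply]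
    exact Fintype.sum_equiv Fin.revPerm _ _ fun j => by simp
  simp only [h] at hvw
  have h1 := finFunctionFinEquiv.injective (Fin.ext hvw)
  funext j
  have := congrFun h1 j.rev
  simp only [Fin.rev_rev] at this
  exact rank_injective this

lemma linearIndependent_of_monic {κ : Type*} (q : κ → ℚ[X]) (hq : ∀ i, (q i).Monic)
    (hinj : Function.Injective fun i => (q i).natDegree) : LinearIndependent ℚ q := by
  rw [linearIndependent_iff']
  intro s g hg i hi
  by_contra hgi
  obtain ⟨m, hm, hmax⟩ := (s.filter fun i => g i ≠ 0).exists_max_image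
    (fun i => (q i).natDegree) ⟨i, by simp [hi, hgi]⟩
  rw [Finset.mem_filter] at hm
  have h := congrArg (fun r => coeff r (q m).natDegree) hg
  simp only [finsetSum_coeff, coeff_smul, smul_eq_mul, coeff_zero] at h
  rw [Finset.sum_eq_single m] at h
  · rw [(hq m).coeff_natDegree, mul_one] at h
    exact hm.2 h
  · intro j hj hjm
    by_cases hgj : g j = 0
    · rw [hgj, zero_mul]
    · rw [coeff_eq_zero_of_natDegree_lt, mul_zero]
      exact lt_of_le_of_ne (hmax j (by simp [hj, hgj])) fun h => hjm (hinj h)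
  · exact fun h => absurd hm.1 h

/-! ### Tensors in coordinates -/

/-- The extension of a matrix, as a derivation, to tensors in coordinates. -/
def deriv (M : Matrix (Fin 3) (Fin 3) ℚ) (n : ℕ) :
    ((Fin n → Fin 3) → ℚ) →ₗ[ℚ] ((Fin n → Fin 3) → ℚ) where
  toFun x w := ∑ i, ∑ b, M (w i) b * x (Function.update w i b)
  map_add' x y := by
    funext w
    simp [mul_add, Finset.sum_add_distrib]
  map_smul' c x := by
    funext w
    simp [Finset.mul_sum, mul_left_comm]

/-- The coefficient tensor of `a` in the first factor. -/
def slice (a : Fin 3) : ((Fin (n + 1) → Fin 3) → ℚ) →ₗ[ℚ] ((Fin n → Fin 3) → ℚ) :=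
  LinearMap.funLeft ℚ ℚ fun w => (Fin.cons a w : Fin (n + 1) → Fin 3)

lemma slice_apply (a : Fin 3) (x : (Fin (n + 1) → Fin 3) → ℚ) (w : Fin n → Fin 3) :
    slice a x w = x (Fin.cons a w) := rfl

lemma ext_slice {x y : (Fin (n + 1) → Fin 3) → ℚ} (h : ∀ a, slice a x = slice a y) : x = y := by
  funext w
  rw [← Fin.cons_self_tail w]
  exact congrFun (h (w 0)) (Fin.tail w)

lemma slice_deriv (M : Matrix (Fin 3) (Fin 3) ℚ) (a : Fin 3) (x : (Fin (n + 1) → Fin 3) → ℚ) :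
    slice a (deriv M (n + 1) x) = ∑ b, M a b • slice b x + deriv M n (slice a x) := by
  funext w
  simp [deriv, slice_apply, Fin.sum_univ_succ (n := n), Fin.cons_update]

/-- Derivations acting in different factors commute, so only the commutators within one factor
remain. -/
lemma deriv_commutator (M N : Matrix (Fin 3) (Fin 3) ℚ) (x : (Fin n → Fin 3) → ℚ) :
    deriv M n (deriv N n x) - deriv N n (deriv M n x) = deriv (M * N - N * M) n x := by
  induction n with
  | zero => funext w; simp [deriv]
  | succ n ih =>
    refine ext_slice fun a => ?_
    rw [map_sub]
    simp only [slice_deriv, map_add, map_sum, map_smul, Matrix.sub_apply, Matrix.mul_apply,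
      sub_smul, Finset.sum_sub_distrib, smul_add, Finset.sum_add_distrib, ← ih, Finset.smul_sum,
      Finset.sum_smul, smul_smul]
    rw [Finset.sum_comm (f := fun x_1 x_2 => (M a x_1 * N x_1 x_2) • slice x_2 x),
      Finset.sum_comm (f := fun x_1 x_2 => (N a x_1 * M x_1 x_2) • slice x_2 x)]
    abel

/-! ### A positive definite form for which `f` is adjoint to `e`. -/

/-- The squared lengths of `h`, `e`, `f` for the form `(x, y) ↦ tr (x yᵀ)`. -/
def sqLength : Fin 3 → ℚ := ![2, 1, 1]

/-- The positive definite form on tensors in coordinates. -/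
def form (x y : (Fin n → Fin 3) → ℚ) : ℚ := ∑ w, (∏ i, sqLength (w i)) * (x w * y w)

lemma form_succ (x y : (Fin (n + 1) → Fin 3) → ℚ) :
    form x y = ∑ a, sqLength a * form (slice a x) (slice a y) := by
  rw [form, ← (Fin.consEquiv fun _ => Fin 3).sum_comp, Fintype.sum_prod_type]
  refine Finset.sum_congr rfl fun a _ => ?_
  rw [form, Finset.mul_sum]
  refine Finset.sum_congr rfl fun w _ => ?_
  simp [Fin.prod_univ_succ, slice_apply, Fin.consEquiv, mul_assoc]

lemma form_add_left (x x' y : (Fin n → Fin 3) → ℚ) : form (x + x') y = form x y + form x' y := by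
  simp [form, add_mul, mul_add, Finset.sum_add_distrib]

lemma form_smul_left (c : ℚ) (x y : (Fin n → Fin 3) → ℚ) : form (c • x) y = c * form x y := by
  simp only [form, Pi.smul_apply, smul_eq_mul, Finset.mul_sum]
  exact Finset.sum_congr rfl fun w _ => by ring

lemma form_comm (x y : (Fin n → Fin 3) → ℚ) : form x y = form y x := by
  simp only [form, mul_comm (x _)]

lemma form_sum_left {κ : Type*} (s : Finset κ) (x : κ → (Fin n → Fin 3) → ℚ)
    (y : (Fin n → Fin 3) → ℚ) : form (∑ i ∈ s, x i) y = ∑ i ∈ s, form (x i) y := by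
  simp only [form, Finset.sum_apply, Finset.sum_mul, Finset.mul_sum]
  exact Finset.sum_comm

lemma form_deriv {M N : Matrix (Fin 3) (Fin 3) ℚ}
    (h : ∀ a b, sqLength a * M a b = sqLength b * N b a) (x y : (Fin n → Fin 3) → ℚ) :
    form (deriv M n x) y = form x (deriv N n y) := by
  induction n with
  | zero => simp [form, deriv]
  | succ n ih =>
    simp only [form_succ, slice_deriv, form_add_left, form_sum_left, form_smul_left, ih]
    simp only [form_comm (slice _ x) (_ + _), form_add_left, form_sum_left, form_smul_left, mul_add,
      Finset.sum_add_distrib, Finset.mul_sum]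
    congr 1
    · rw [Finset.sum_comm]
      refine Finset.sum_congr rfl fun b _ => Finset.sum_congr rfl fun a _ => ?_
      rw [← mul_assoc, ← mul_assoc, h, form_comm]
    · exact Finset.sum_congr rfl fun a _ => by rw [form_comm]

lemma sqLength_pos (a : Fin 3) : 0 < sqLength a := by fin_cases a <;> simp [sqLength]

lemma form_self_nonneg (x : (Fin n → Fin 3) → ℚ) : 0 ≤ form x x :=
  Finset.sum_nonneg fun _ _ =>
    mul_nonneg (Finset.prod_nonneg fun _ _ => (sqLength_pos _).le) (mul_self_nonneg _)

lemma eq_zero_of_form_self {x : (Fin n → Fin 3) → ℚ} (h : form x x ≤ 0) : x = 0 := by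
  have h0 := le_antisymm h (form_self_nonneg x)
  rw [form, Finset.sum_eq_zero_iff_of_nonneg fun _ _ =>
    mul_nonneg (Finset.prod_nonneg fun _ _ => (sqLength_pos _).le) (mul_self_nonneg _)] at h0
  funext w
  have h1 := h0 w (Finset.mem_univ w)
  have h2 : (∏ i, sqLength (w i)) ≠ 0 := Finset.prod_ne_zero_iff.2 fun i _ => (sqLength_pos _).ne'
  simpa [h2] using h1

/-! ### Highest weight vectors -/

/-- The tensors of weight `2 k` that are killed by `e`. -/
structure IsHighest (k : ℤ) (x : (Fin n → Fin 3) → ℚ) : Prop where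
  e_eq_zero : deriv (adMatrix 1) n x = 0
  h_eq : deriv (adMatrix 0) n x = (2 * k : ℚ) • x

lemma form_deriv_f (x y : (Fin n → Fin 3) → ℚ) :
    form (deriv (adMatrix 2) n x) y = form x (deriv (adMatrix 1) n y) := by
  refine form_deriv (fun a b => ?_) x y
  fin_cases a <;> fin_cases b <;> simp [adMatrix, sqLength]

/-- `⟨f x, f x⟩ = ⟨x, e f x⟩ = ⟨x, h x⟩`, because `e x = 0` and `[e, f] = h`. Positivity then
excludes negative weights and forces `f x = 0` in weight zero. -/
lemma IsHighest.form_f {k : ℤ} {x : (Fin n → Fin 3) → ℚ} (hx : IsHighest k x) :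
    form (deriv (adMatrix 2) n x) (deriv (adMatrix 2) n x) = 2 * k * form x x := by
  have h1 : adMatrix 1 * adMatrix 2 - adMatrix 2 * adMatrix 1 = adMatrix 0 := by
    ext a b
    fin_cases a <;> fin_cases b <;>
      simp [adMatrix]
  have h2 := deriv_commutator (adMatrix 1) (adMatrix 2) x
  rw [h1, hx.e_eq_zero, map_zero, sub_zero, hx.h_eq] at h2
  rw [form_deriv_f, h2, form_comm, form_smul_left]

lemma IsHighest.eq_zero_of_neg {k : ℤ} {x : (Fin n → Fin 3) → ℚ} (hx : IsHighest k x)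
    (hk : k < 0) : x = 0 := by
  refine eq_zero_of_form_self ?_
  have h1 := hx.form_f
  have h2 := form_self_nonneg (deriv (adMatrix 2) n x)
  have hk' : (k : ℚ) < 0 := by exact_mod_cast hk
  by_contra! h
  nlinarith

lemma IsHighest.f_eq_zero {x : (Fin n → Fin 3) → ℚ} (hx : IsHighest 0 x) :
    deriv (adMatrix 2) n x = 0 :=
  eq_zero_of_form_self (by rw [hx.form_f]; simp)

/-- A word from left to right describes a path: `f` is a step up, `h` is a level step, which is not
allowed at height zero, and `e` is a step down. The path goes from height `k` to height zero. -/
def IsPath : ∀ {n : ℕ}, (Fin n → Fin 3) → ℕ → Prop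
  | 0, _, k => k = 0
  | _ + 1, w, k => (w 0 = 2 ∧ IsPath (Fin.tail w) (k + 1)) ∨
      (w 0 = 0 ∧ 0 < k ∧ IsPath (Fin.tail w) k) ∨ (w 0 = 1 ∧ 0 < k ∧ IsPath (Fin.tail w) (k - 1))

/-- Write `x = h ⊗ x₀ + e ⊗ x₁ + f ⊗ x₂`. Then `e x = 0` reads `e x₂ = 0`, `e x₀ = -x₂`, `e x₁ = 2
x₀`. So `x₂` is highest of weight `2(k + 1)`; once it vanishes, `x₀` is highest of weight `2k`; once
that vanishes, `x₁` is highest of weight `2(k - 1)`. These are the heights after the steps `f`, `h`,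
`e`. -/
lemma IsHighest.eq_zero {k : ℕ} {x : (Fin n → Fin 3) → ℚ} (hx : IsHighest k x)
    (h : ∀ w, IsPath w k → x w = 0) : x = 0 := by
  induction n generalizing k with
  | zero =>
    funext w
    by_cases hk : k = 0
    · exact h w hk
    · have h1 := congrFun hx.h_eq w
      have hk' : (k : ℚ) ≠ 0 := by exact_mod_cast hk
      simpa [deriv, hk'] using h1.symm
  | succ n ih =>
    have he (a : Fin 3) : slice a (deriv (adMatrix 1) (n + 1) x) = 0 := by
      rw [hx.e_eq_zero, map_zero]
    have hh (a : Fin 3) : slice a (deriv (adMatrix 0) (n + 1) x) = (2 * k : ℚ) • slice a x := by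
      rw [hx.h_eq, map_smul]
      rfl
    have e0 : slice 2 x + deriv (adMatrix 1) n (slice 0 x) = 0 := by
      simpa [slice_deriv, Fin.sum_univ_three, adMatrix] using he 0
    have e1 : (-2 : ℚ) • slice 0 x + deriv (adMatrix 1) n (slice 1 x) = 0 := by
      simpa [slice_deriv, Fin.sum_univ_three, adMatrix] using he 1
    have e2 : deriv (adMatrix 1) n (slice 2 x) = 0 := by
      simpa [slice_deriv, Fin.sum_univ_three, adMatrix] using he 2
    have h0 : deriv (adMatrix 0) n (slice 0 x) = (2 * k : ℚ) • slice 0 x := by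
      simpa [slice_deriv, Fin.sum_univ_three, adMatrix] using hh 0
    have h1 : (2 : ℚ) • slice 1 x + deriv (adMatrix 0) n (slice 1 x) = (2 * k : ℚ) • slice 1 x := by
      simpa [slice_deriv, Fin.sum_univ_three, adMatrix] using hh 1
    have h2 : (-2 : ℚ) • slice 2 x + deriv (adMatrix 0) n (slice 2 x) =
        (2 * k : ℚ) • slice 2 x := by
      simpa [slice_deriv, Fin.sum_univ_three, adMatrix] using hh 2
    have z2 : slice 2 x = 0 := by
      refine ih (k := k + 1) ⟨e2, ?_⟩ fun w hw => h _ (Or.inl ⟨rfl, hw⟩)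
      have : deriv (adMatrix 0) n (slice 2 x) = (2 * k : ℚ) • slice 2 x + (2 : ℚ) • slice 2 x := by
        rw [← h2]; module
      rw [this]; push_cast; module
    rw [z2, zero_add] at e0
    have z0 : slice 0 x = 0 := by
      rcases Nat.eq_zero_or_pos k with rfl | hk
      -- A level step at height zero is not a path, so no coefficients are assumed to vanish here.
      -- Instead `2⟨x₀, x₀⟩ = ⟨x₀, e x₁⟩ = ⟨f x₀, x₁⟩ = 0`.
      · have hz : IsHighest 0 (slice 0 x) := ⟨e0, by simpa using h0⟩
        have e1' : deriv (adMatrix 1) n (slice 1 x) = (2 : ℚ) • slice 0 x := by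
          rw [← sub_eq_zero, ← e1]; module
        have := form_deriv_f (slice 0 x) (slice 1 x)
        rw [hz.f_eq_zero, e1', form_comm _ (_ • _), form_smul_left] at this
        refine eq_zero_of_form_self (le_of_eq ?_)
        simpa [form] using this.symm
      · exact ih (k := k) ⟨e0, h0⟩ fun w hw => h _ (Or.inr (Or.inl ⟨rfl, hk, hw⟩))
    rw [z0, smul_zero, zero_add] at e1
    have z1 : slice 1 x = 0 := by
      have hz : IsHighest ((k : ℤ) - 1) (slice 1 x) := by
        refine ⟨e1, ?_⟩
        have : deriv (adMatrix 0) n (slice 1 x) =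
          (2 * k : ℚ) • slice 1 x - (2 : ℚ) • slice 1 x := by rw [← h1]; module
        rw [this]; push_cast; module
      rcases Nat.eq_zero_or_pos k with rfl | hk
      · exact hz.eq_zero_of_neg (by norm_num)
      · refine ih (k := k - 1) (by rwa [Nat.cast_sub hk]) fun w hw =>
          h _ (Or.inr (Or.inr ⟨rfl, hk, hw⟩))
    refine ext_slice fun a => ?_
    rw [map_zero]
    fin_cases a
    · exact z0
    · exact z1
    · exact z2

/-! ### The upper bound for the dimension -/

/-- The basis of `sl₂^{⊗n}` given by the words in `h`, `e`, `f`. -/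
def wordBasis (n : ℕ) : Module.Basis (Fin n → Fin 3) ℚ (TensorPower n) :=
  Basis.piTensorProduct fun _ => genBasis

lemma wordBasis_repr_act (y : Fin 3) (t : TensorPower n) :
    (wordBasis n).equivFun (act n (gen y) t) = deriv (adMatrix y) n ((wordBasis n).equivFun t) := by
  have key : (wordBasis n).equivFun.toLinearMap ∘ₗ act n (gen y) =
      deriv (adMatrix y) n ∘ₗ (wordBasis n).equivFun.toLinearMap := by
    refine PiTensorProduct.ext (MultilinearMap.ext fun v => funext fun w => ?_)
    have h (u : Fin n → sl2) (w : Fin n → Fin 3) :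
        (wordBasis n).repr (PiTensorProduct.tprod ℚ u) w = ∏ i, genBasis.repr (u i) (w i) :=
      Basis.piTensorProduct_repr_tprod_apply _ _ _
    simp only [LinearMap.compMultilinearMap_apply, LinearMap.comp_apply, act, LinearMap.sum_apply,
      PiTensorProduct.map_tprod, map_sum, LinearEquiv.coe_coe, Finset.sum_apply,
      Module.Basis.equivFun_apply, deriv, LinearMap.coe_mk, AddHom.coe_mk, h]
    refine Finset.sum_congr rfl fun i _ => ?_
    rw [← Finset.mul_prod_erase _ _ (Finset.mem_univ i)]
    simp only [Function.update_self, LieAlgebra.ad_apply, genBasis_repr_lie, Finset.sum_mul]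
    refine Finset.sum_congr rfl fun b _ => ?_
    rw [← Finset.mul_prod_erase _ _ (Finset.mem_univ i), Function.update_self, mul_assoc]
    congr 2
    refine Finset.prod_congr rfl fun j hj => ?_
    rw [Function.update_of_ne (Finset.ne_of_mem_erase hj),
      Function.update_of_ne (Finset.ne_of_mem_erase hj)]
    rfl
  exact LinearMap.congr_fun key t

lemma finrank_Inv_le (n : ℕ) :
    Module.finrank ℚ (Inv n) ≤ Nat.card {w : Fin n → Fin 3 // IsPath w 0} := by
  classical
  let g : Inv n →ₗ[ℚ] ({w : Fin n → Fin 3 // IsPath w 0} → ℚ) :=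
    LinearMap.funLeft ℚ ℚ Subtype.val ∘ₗ (wordBasis n).equivFun.toLinearMap ∘ₗ (Inv n).subtype
  have hg : Function.Injective g := by
    rw [injective_iff_map_eq_zero]
    rintro ⟨t, ht⟩ h
    have hh : act n (gen 0) t = 0 := ht.1.1
    have he : act n (gen 1) t = 0 := ht.1.2
    have h0 : (wordBasis n).equivFun t = 0 := by
      refine IsHighest.eq_zero (k := 0) ⟨?_, ?_⟩ fun w hw => congrFun h ⟨w, hw⟩
      · rw [← wordBasis_repr_act, he, map_zero]
      · rw [← wordBasis_repr_act, hh, map_zero]; simp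
    exact Subtype.ext ((LinearEquiv.map_eq_zero_iff _).1 h0)
  have := LinearMap.finrank_le_finrank_of_injective hg
  rwa [Module.finrank_fintype_fun_eq_card, ← Nat.card_eq_fintype_card] at this

/-! ### Counting paths -/

/-- The trinomial coefficients: the coefficients of `(X + 1 + X⁻¹) ^ n`. -/
def trinomial : ℕ → ℤ → ℚ
  | 0, k => if k = 0 then 1 else 0
  | n + 1, k => trinomial n (k - 1) + trinomial n k + trinomial n (k + 1)

lemma trinomial_neg (n : ℕ) (k : ℤ) : trinomial n (-k) = trinomial n k := by
  induction n generalizing k with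
  | zero => simp [trinomial]
  | succ n ih =>
    rw [trinomial, trinomial, ← ih (k - 1), ← ih (k + 1), ih k, neg_sub, neg_add,
      show -k - 1 = -k + -1 by ring, show -k + 1 = 1 - k by ring]
    ring

/-- Coefficients of `X · d/dX` applied to `(X + 1 + X⁻¹) ^ (n + 1)`, which gives `(n + 1) (X + 1 +
X⁻¹) ^ n (X - X⁻¹)`. -/
lemma mul_trinomial_succ (n : ℕ) (k : ℤ) : k * trinomial (n + 1) k =
    (n + 1) * (trinomial n (k - 1) - trinomial n (k + 1)) := by
  induction n generalizing k with
  | zero =>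
    simp only [trinomial]
    by_cases h1 : k = 1
    · subst h1; norm_num
    by_cases h2 : k = 0
    · subst h2; norm_num
    by_cases h3 : k = -1
    · subst h3; norm_num
    rw [if_neg (by omega), if_neg (by omega), if_neg (by omega)]
    simp
  | succ n ih =>
    have h1 := ih (k - 1)
    have h2 := ih k
    have h3 := ih (k + 1)
    rw [trinomial]
    have e1 : trinomial (n + 1) (k - 1) =
      trinomial n (k - 1 - 1) + trinomial n (k - 1) + trinomial n (k - 1 + 1) := rfl
    have e3 : trinomial (n + 1) (k + 1) =
      trinomial n (k + 1 - 1) + trinomial n (k + 1) + trinomial n (k + 1 + 1) := rfl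
    have a1 : k - 1 + 1 = k := by ring
    have a2 : k + 1 - 1 = k := by ring
    rw [a1] at h1 e1
    rw [a2] at h3 e3
    push_cast at h1 h3 ⊢
    linear_combination h1 + h2 + h3 - (n + 1 : ℚ) * e1 + (n + 1 : ℚ) * e3

lemma riordanNumber_eq (n : ℕ) : riordanNumber n = trinomial n 0 - trinomial n 1 := by
  induction n using Nat.strong_induction_on with
  | _ n ih =>
    match n with
    | 0 => simp [riordanNumber, trinomial]
    | 1 => simp [riordanNumber, trinomial]
    | m + 2 =>
      rw [riordanNumber, ih (m + 1) (by omega), ih m (by omega)]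
      have hm : (m : ℚ) + 3 ≠ 0 := by positivity
      rw [div_eq_iff hm]
      have r1 := mul_trinomial_succ m 1
      have r2 := mul_trinomial_succ m 2
      have n1 := trinomial_neg m 1
      simp only [trinomial] at r1 r2 ⊢
      have n2 := trinomial_neg m 2
      norm_num [n1, n2] at r1 r2 ⊢
      linear_combination r2 - 2 * r1

-- Reflection principle: `trinomial n k - trinomial n (k + 1)` satisfies the free three-term
-- recurrence and is antisymmetric under `k ↦ -1 - k`. Hence its values at `0` and `-1` cancel,
-- which accounts for the forbidden level and down steps at height zero.
open Classical in
lemma card_isPath (n k : ℕ) : (Nat.card {w : Fin n → Fin 3 // IsPath w k} : ℚ) =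
    trinomial n k - trinomial n (k + 1) := by
  rw [Nat.card_eq_fintype_card, Fintype.card_subtype, Finset.card_filter]
  induction n generalizing k with
  | zero =>
    have h1 : ¬ (k : ℤ) + 1 = 0 := by omega
    by_cases hk : k = 0 <;> simp [trinomial, IsPath, h1, hk]
  | succ n ih =>
    push_cast at ih ⊢
    rw [← (Fin.consEquiv fun _ => Fin 3).sum_comp, Fintype.sum_prod_type, Fin.sum_univ_three]
    have h0 (w : Fin n → Fin 3) : IsPath (Fin.cons 0 w : Fin (n + 1) → Fin 3) k ↔
        0 < k ∧ IsPath w k := by simp [IsPath]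
    have h1 (w : Fin n → Fin 3) : IsPath (Fin.cons 1 w : Fin (n + 1) → Fin 3) k ↔
        0 < k ∧ IsPath w (k - 1) := by simp [IsPath]
    have h2 (w : Fin n → Fin 3) : IsPath (Fin.cons 2 w : Fin (n + 1) → Fin 3) k ↔
        IsPath w (k + 1) := by simp [IsPath]
    have hc (a : Fin 3) (w : Fin n → Fin 3) :
      (Fin.consEquiv fun _ => Fin 3) (a, w) = (Fin.cons a w : Fin (n + 1) → Fin 3) := rfl
    simp only [hc, h0, h1, h2, ih]
    rcases Nat.eq_zero_or_pos k with rfl | hk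
    · have n1 := trinomial_neg n 1
      simp [trinomial, n1]
      ring_nf
    · simp only [hk, true_and, ih, trinomial]
      push_cast [Nat.cast_sub hk]
      ring_nf

/-! ### Riordan partitions and paths -/

/-- A step of the comparison of two non-crossing relations that agree before `i`: the predecessor of
`i` for `t` is not greater than the predecessor for `s`. -/
lemma not_pred_lt_pred {s t : Setoid (Fin n)}
    (hs : ∀ a b c d, a < b → b < c → c < d → s a c → s b d → s a b)
    (hmax : ∀ i, (∀ j, s i j → j ≤ i) → ∀ j, t i j → j ≤ i)
    {i a b : Fin n} (ih : ∀ j m, j < i → m < i → (s j m ↔ t j m))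
    (hai : s a i) (ha : ∀ c, c < i → s c i → c ≤ a)
    (hb : b < i) (hbi : t b i) (hb' : ∀ c, c < i → t c i → c ≤ b) : ¬ a < b := by
  intro hab
  have hsbi : ¬ s b i := fun h => absurd (ha b hb h) (not_le.2 hab)
  -- For `t`, `b` is not greatest in its class because of `i`, hence neither for `s`. Its larger
  -- partner `d` either lies before `i` and contradicts the choice of `b`, or is `i`, or lies beyond
  -- `i` and makes `a < b < i < d` a crossing.
  have h1 : ∃ d, s b d ∧ b < d := by
    by_contra! h
    exact absurd (hmax b h i hbi) (not_le.2 hb)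
  obtain ⟨d, hbd, hd⟩ := h1
  rcases lt_trichotomy d i with hdi | rfl | hdi
  · have h2 : t b d := (ih b d hb hdi).1 hbd
    exact absurd (hb' d hdi (t.trans (t.symm h2) hbi)) (not_le.2 hd)
  · exact hsbi hbd
  · exact hsbi (s.trans (s.symm (hs a b i d hab hb hdi hai hbd)) hai)

lemma exists_pred {s : Setoid (Fin n)} {i : Fin n} (h : ∃ j, j < i ∧ s j i) :
    ∃ a, a < i ∧ s a i ∧ ∀ c, c < i → s c i → c ≤ a := by
  classical
  obtain ⟨j, hj⟩ := h
  obtain ⟨a, ha, hmax⟩ := (Finset.univ.filter fun j => j < i ∧ s j i).exists_max_image id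
    ⟨j, by simpa using hj⟩
  simp only [Finset.mem_filter, Finset.mem_univ, true_and, id] at ha hmax
  exact ⟨a, ha.1, ha.2, fun c hc hci => hmax c ⟨hc, hci⟩⟩

/-- A non-crossing equivalence relation is determined by the least and the greatest elements of its
classes. -/
lemma setoid_eq_of_noncrossing {s t : Setoid (Fin n)}
    (hs : ∀ a b c d, a < b → b < c → c < d → s a c → s b d → s a b)
    (ht : ∀ a b c d, a < b → b < c → c < d → t a c → t b d → t a b)
    (hmin : ∀ i, (∀ j, s i j → i ≤ j) ↔ ∀ j, t i j → i ≤ j)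
    (hmax : ∀ i, (∀ j, s i j → j ≤ i) ↔ ∀ j, t i j → j ≤ i) : s = t := by
  have key : ∀ i j, j < i → (s j i ↔ t j i) := by
    intro i
    induction i using WellFoundedLT.induction with
    | ind i ih =>
      have ih' : ∀ j m, j < i → m < i → (s j m ↔ t j m) := by
        intro j m hj hm
        rcases lt_trichotomy j m with h | rfl | h
        · exact ih m hm j h
        · exact iff_of_true (s.refl j) (t.refl j)
        · exact ⟨fun h' => t.symm ((ih j hj m h).1 (s.symm h')),
            fun h' => s.symm ((ih j hj m h).2 (t.symm h'))⟩
      -- Having a predecessor means not being least in the class, a property shared by `s` and `t`.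
      have hex : (∃ j, j < i ∧ s j i) ↔ ∃ j, j < i ∧ t j i := by
        have h1 (r : Setoid (Fin n)) : (∃ j, j < i ∧ r j i) ↔ ¬ ∀ j, r i j → i ≤ j := by
          push Not
          exact exists_congr fun j => ⟨fun h => ⟨r.symm h.2, h.1⟩, fun h => ⟨h.2, r.symm h.1⟩⟩
        rw [h1, h1, hmin]
      intro j hj
      by_cases hex' : ∃ j, j < i ∧ s j i
      · obtain ⟨a, ha, hai, ha'⟩ := exists_pred hex'
        obtain ⟨b, hb, hbi, hb'⟩ := exists_pred (hex.1 hex')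
        have hab : a = b := le_antisymm
          (not_lt.1 (not_pred_lt_pred ht (fun i => (hmax i).2) (fun j m hj hm => (ih' j m hj hm).symm)
            hbi hb' ha hai ha'))
          (not_lt.1 (not_pred_lt_pred hs (fun i => (hmax i).1) ih' hai ha' hb hbi hb'))
        subst hab
        exact ⟨fun h => t.trans ((ih' j a hj ha).1 (s.trans h (s.symm hai))) hbi,
          fun h => s.trans ((ih' j a hj ha).2 (t.trans h (t.symm hbi))) hai⟩
      · exact iff_of_false (fun h => hex' ⟨j, hj, h⟩) fun h => hex' (hex.2 ⟨j, hj, h⟩)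
  refine Setoid.ext fun i j => ?_
  rcases lt_trichotomy i j with h | rfl | h
  · exact key j i h
  · exact iff_of_true (s.refl i) (t.refl i)
  · exact ⟨fun h' => t.symm ((key i j h).1 (s.symm h')), fun h' => s.symm ((key i j h).2 (t.symm h'))⟩

/-- The equivalence relation of a partition. -/
def partSetoid (P : Finpartition (Finset.univ : Finset (Fin n))) : Setoid (Fin n) :=
  Setoid.ker P.part

lemma partSetoid_iff (P : Finpartition (Finset.univ : Finset (Fin n))) (i j : Fin n) :
    partSetoid P i j ↔ j ∈ P.part i := by
  rw [P.mem_part_iff_part_eq_part (Finset.mem_univ _) (Finset.mem_univ _)]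
  exact eq_comm

lemma IsRiordanPartition.partSetoid_noncrossing
    {P : Finpartition (Finset.univ : Finset (Fin n))} (hP : IsRiordanPartition P)
    (a b c d : Fin n) (hab : a < b) (hbc : b < c) (hcd : c < d) (hac : partSetoid P a c)
    (hbd : partSetoid P b d) : partSetoid P a b := by
  by_contra h
  rw [partSetoid_iff] at hac hbd
  exact hP.noncrossing _ (P.part_mem.2 (Finset.mem_univ a)) _ (P.part_mem.2 (Finset.mem_univ b)) h a
    (P.mem_part (Finset.mem_univ a)) b (P.mem_part (Finset.mem_univ b)) c hac d hbd ⟨hab, hbc, hcd⟩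

lemma word_eq_two_iff (P : Finpartition (Finset.univ : Finset (Fin n))) (i : Fin n) :
    word P i = 2 ↔ ∀ j, partSetoid P i j → i ≤ j := by
  simp only [partSetoid_iff, word, letter]
  split_ifs with h1 h2
  · exact iff_of_true rfl h1
  · exact iff_of_false (by decide) h1
  · exact iff_of_false (by decide) h1

/-- A singleton would receive the letter `f`, since `letter` tests for the first element first;
parts of size at least two rule this out. -/
lemma IsRiordanPartition.word_eq_one_iff {P : Finpartition (Finset.univ : Finset (Fin n))}
    (hP : IsRiordanPartition P) (i : Fin n) :
    word P i = 1 ↔ ∀ j, partSetoid P i j → j ≤ i := by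
  simp only [partSetoid_iff, word, letter]
  split_ifs with h1 h2
  · refine iff_of_false (by decide) fun h2 => ?_
    have h3 : P.part i ⊆ {i} := fun j hj =>
      Finset.mem_singleton.2 (le_antisymm (h2 j hj) (h1 j hj))
    have h4 := hP.two_le_card _ (P.part_mem.2 (Finset.mem_univ i))
    have h5 := Finset.card_le_card h3
    rw [Finset.card_singleton] at h5
    omega
  · exact iff_of_true rfl h2
  · exact iff_of_false (by decide) h2

lemma IsRiordanPartition.word_injective {P Q : Finpartition (Finset.univ : Finset (Fin n))}
    (hP : IsRiordanPartition P) (hQ : IsRiordanPartition Q) (h : word P = word Q) : P = Q := by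
  have hs : partSetoid P = partSetoid Q := by
    refine setoid_eq_of_noncrossing hP.partSetoid_noncrossing hQ.partSetoid_noncrossing
      (fun i => ?_) fun i => ?_
    · rw [← word_eq_two_iff, ← word_eq_two_iff, h]
    · rw [← hP.word_eq_one_iff, ← hQ.word_eq_one_iff, h]
  have hpart (i : Fin n) : P.part i = Q.part i := by
    ext j
    rw [← partSetoid_iff, ← partSetoid_iff, hs]
  have hle {P Q : Finpartition (Finset.univ : Finset (Fin n))} (h : ∀ i, P.part i = Q.part i)
      (p) (hp : p ∈ P.parts) : p ∈ Q.parts := by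
    obtain ⟨i, hi⟩ := P.nonempty_of_mem_parts hp
    rw [← P.part_eq_of_mem hp hi, h]
    exact Q.part_mem.2 (Finset.mem_univ i)
  ext p
  exact ⟨hle hpart p, hle (fun i => (hpart i).symm) p⟩

/-! ### From paths to Riordan partitions. -/

/-- The heights of a path. -/
structure IsHeight (w : Fin n → Fin 3) (H : ℕ → ℕ) : Prop where
  last : H n = 0
  step : ∀ i : Fin n, (w i = 2 ∧ H (i + 1) = H i + 1) ∨ (w i = 0 ∧ 0 < H i ∧ H (i + 1) = H i) ∨
    (w i = 1 ∧ H i = H (i + 1) + 1)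

lemma IsPath.exists_isHeight {w : Fin n → Fin 3} {k : ℕ} (h : IsPath w k) :
    ∃ H, H 0 = k ∧ IsHeight w H := by
  induction n generalizing k with
  | zero => exact ⟨fun _ => k, rfl, h, fun i => i.elim0⟩
  | succ n ih =>
    have key (k' : ℕ) (h' : IsPath (Fin.tail w) k')
        (h0 : (w 0 = 2 ∧ k' = k + 1) ∨ (w 0 = 0 ∧ 0 < k ∧ k' = k) ∨ (w 0 = 1 ∧ k = k' + 1)) :
        ∃ H, H 0 = k ∧ IsHeight w H := by
      obtain ⟨H, hH0, hH⟩ := ih h'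
      refine ⟨fun m => Nat.casesOn m k H, rfl, hH.last, fun i => ?_⟩
      refine Fin.cases ?_ (fun i => ?_) i
      · simpa [hH0] using h0
      · exact hH.step i
    rcases h with ⟨h0, h⟩ | ⟨h0, hk, h⟩ | ⟨h0, hk, h⟩
    · exact key _ h (Or.inl ⟨h0, rfl⟩)
    · exact key _ h (Or.inr (Or.inl ⟨h0, hk, rfl⟩))
    · exact key _ h (Or.inr (Or.inr ⟨h0, by omega⟩))

/-- The level of a step of a path is the height of its upper end. -/
def level (H : ℕ → ℕ) (i : ℕ) : ℕ := max (H i) (H (i + 1))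

/-- Two steps are equivalent if they have the same level and the path does not pass below this level
between them. -/
def levelSetoid (n : ℕ) (H : ℕ → ℕ) : Setoid (Fin n) where
  r i j := level H i = level H j ∧ ∀ m : ℕ, min (i : ℕ) j < m → m ≤ max (i : ℕ) j → level H i ≤ H m
  iseqv :=
    { refl := fun i => ⟨rfl, fun m h1 h2 => by omega⟩
      symm := fun {i j} h => ⟨h.1.symm, fun m h1 h2 => by
        rw [← h.1]; exact h.2 m (by omega) (by omega)⟩
      trans := fun {i j k} h h' => ⟨h.1.trans h'.1, fun m h1 h2 => by
        by_cases hm : min (i : ℕ) j < m ∧ m ≤ max (i : ℕ) j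
        · exact h.2 m hm.1 hm.2
        · rw [h.1]
          exact h'.2 m (by omega) (by omega)⟩ }

lemma levelSetoid_iff_of_lt {H : ℕ → ℕ} {i j : Fin n} (hij : i < j) : levelSetoid n H i j ↔
    level H i = level H j ∧ ∀ m : ℕ, (i : ℕ) < m → m ≤ j → level H i ≤ H m := by
  have hij' : (i : ℕ) < j := hij
  change (level H i = level H j ∧ ∀ m : ℕ, min (i : ℕ) j < m → m ≤ max (i : ℕ) j →
    level H i ≤ H m) ↔ _
  rw [min_eq_left hij'.le, max_eq_right hij'.le]

/-- Since `b` lies between `a` and `c`, `level a ≤ H b ≤ level b`; since `c` lies between `b` and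
`d`, `level b ≤ H c ≤ level c = level a`. -/
lemma levelSetoid_noncrossing (H : ℕ → ℕ) (a b c d : Fin n) (hab : a < b) (hbc : b < c)
    (hcd : c < d) (hac : levelSetoid n H a c) (hbd : levelSetoid n H b d) :
    levelSetoid n H a b := by
  rw [levelSetoid_iff_of_lt (hab.trans hbc)] at hac
  rw [levelSetoid_iff_of_lt (hbc.trans hcd)] at hbd
  rw [levelSetoid_iff_of_lt hab]
  have h1 := hac.2 b hab hbc.le
  have h2 := hbd.2 c hbc hcd.le
  have h3 : H b ≤ level H b := le_max_left _ _
  have h4 : H c ≤ level H c := le_max_left _ _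
  exact ⟨by omega, fun m hm1 hm2 => hac.2 m hm1 (hm2.trans (Nat.le_of_lt hbc))⟩

/-- An up step starts below its level, which cuts it off from all earlier steps. Any other step
starts at its level, at positive height, and is equivalent to the up step that last reached this
height from below. -/
lemma IsHeight.eq_two_iff {w : Fin n → Fin 3} {H : ℕ → ℕ} (hH : IsHeight w H) (h0 : H 0 = 0)
    (i : Fin n) : w i = 2 ↔ ∀ j, levelSetoid n H i j → i ≤ j := by
  constructor
  · intro hw j hj
    by_contra! hji
    have h1 := ((levelSetoid_iff_of_lt hji).1 ((levelSetoid n H).symm hj))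
    have h2 := h1.2 i hji le_rfl
    have h3 : H (i + 1) ≤ level H i := le_max_right _ _
    have := hH.step i
    simp only [hw] at this
    simp at this
    omega
  · intro h
    by_contra hw
    have h1 : level H i = H i ∧ 0 < H i := by
      have := hH.step i
      simp only [hw, false_and, false_or] at this
      rw [level]
      omega
    -- The last earlier time below `H i`; time `0` qualifies because `H 0 = 0`.
    have h2 := Nat.findGreatest_spec (P := fun m => H m < H i) (Nat.zero_le i) (by omega)
    have h2' := Nat.findGreatest_le (P := fun m => H m < H i) (i : ℕ)
    have h3 := fun m => Nat.findGreatest_is_greatest (P := fun m => H m < H i) (n := i) (k := m)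
    generalize Nat.findGreatest (fun m => H m < H i) i = j at h2 h2' h3
    have hji : j < i := lt_of_le_of_ne h2' fun h => by subst h; omega
    have h4 := h3 (j + 1) (by omega) (by omega)
    have h5 := hH.step ⟨j, hji.trans i.2⟩
    simp only at h5
    have h6 : level H j = H i := by rw [level]; omega
    have h7 := h ⟨j, hji.trans i.2⟩ ((levelSetoid n H).symm
      ((levelSetoid_iff_of_lt hji).2 ⟨h6.trans h1.1.symm, fun m hm1 hm2 => by
        have := h3 m hm1 hm2
        simp only at h6 ⊢
        omega⟩))
    exact absurd h7 (not_le.2 hji)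

/-- The mirror image: a step that does not go down is matched with the down step at which the path
first drops below its level, which happens since `H n = 0`. -/
lemma IsHeight.eq_one_iff {w : Fin n → Fin 3} {H : ℕ → ℕ} (hH : IsHeight w H)
    (i : Fin n) : w i = 1 ↔ ∀ j, levelSetoid n H i j → j ≤ i := by
  constructor
  · intro hw j hj
    by_contra! hij
    have h1 := ((levelSetoid_iff_of_lt hij).1 hj)
    have h2 := h1.2 (i + 1) (Nat.lt_succ_self _) hij
    have h3 : H i ≤ level H i := le_max_left _ _
    have := hH.step i
    simp only [hw] at this
    simp at this
    omega
  · intro h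
    by_contra hw
    have h1 : level H i = H (i + 1) ∧ 0 < H (i + 1) := by
      have := hH.step i
      simp only [hw, false_and, or_false] at this
      rw [level]
      omega
    have hex : ∃ m, (i : ℕ) + 1 ≤ m ∧ H m < H (i + 1) := ⟨n, i.2, by rw [hH.last]; exact h1.2⟩
    have h2 := Nat.find_spec hex
    have h3 := fun m => Nat.find_min hex (m := m)
    have h3' := Nat.find_min' hex (m := n) ⟨i.2, by rw [hH.last]; exact h1.2⟩
    generalize Nat.find hex = j at h2 h3 h3'
    have hij : (i : ℕ) + 1 < j := lt_of_le_of_ne h2.1 fun h => by subst h; omega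
    obtain ⟨j, rfl⟩ : ∃ j', j = j' + 1 := ⟨j - 1, by omega⟩
    have h4 := h3 j (by omega)
    have h5 := hH.step ⟨j, h3'⟩
    simp only at h5
    have h6 : level H j = H (i + 1) := by rw [level]; omega
    have hij' : i < (⟨j, h3'⟩ : Fin n) := Fin.lt_def.2 (by simp only; omega)
    have h7 := h ⟨j, h3'⟩ ((levelSetoid_iff_of_lt hij').2 ⟨h1.1.trans h6.symm, fun m hm1 hm2 => by
      simp only at hm2
      have := h3 m (by omega)
      omega⟩)
    exact absurd h7 (not_le.2 hij')

lemma IsPath.exists_word_eq {w : Fin n → Fin 3} (h : IsPath w 0) :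
    ∃ P : Finpartition (Finset.univ : Finset (Fin n)), IsRiordanPartition P ∧ word P = w := by
  classical
  obtain ⟨H, h0, hH⟩ := h.exists_isHeight
  let P := Finpartition.ofSetoid (levelSetoid n H)
  have hmem (i j : Fin n) : j ∈ P.part i ↔ levelSetoid n H i j :=
    Finpartition.mem_part_ofSetoid_iff_rel
  have hP : IsRiordanPartition P := by
    constructor
    · intro p hp
      obtain ⟨i, hi⟩ := P.nonempty_of_mem_parts hp
      rw [← P.part_eq_of_mem hp hi]
      -- A step alone in its class would be both an up step and a down step.
      have hex : ∃ j, levelSetoid n H i j ∧ i ≠ j := by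
        by_contra! hne
        have h2 : w i = 2 := (hH.eq_two_iff h0 i).2 fun j hj => (hne j hj).le
        have h1 : w i = 1 := (hH.eq_one_iff i).2 fun j hj => (hne j hj).ge
        rw [h1] at h2
        exact absurd h2 (by decide)
      obtain ⟨j, hj, hij⟩ := hex
      exact Finset.one_lt_card.2 ⟨i, P.mem_part (Finset.mem_univ i), j, (hmem i j).2 hj, hij⟩
    · rintro p hp q hq hpq a ha b hb c hc d hd ⟨hab, hbc, hcd⟩
      have ea := P.part_eq_of_mem hp ha
      have eb := P.part_eq_of_mem hq hb
      rw [← ea] at hc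
      rw [← eb] at hd
      have h1 := levelSetoid_noncrossing H a b c d hab hbc hcd ((hmem a c).1 hc) ((hmem b d).1 hd)
      have h2 := (hmem a b).2 h1
      rw [P.mem_part_iff_part_eq_part (Finset.mem_univ _) (Finset.mem_univ _), ea, eb] at h2
      exact hpq h2.symm
  refine ⟨P, hP, funext fun i => ?_⟩
  have h2 : word P i = 2 ↔ w i = 2 := by
    rw [word_eq_two_iff, hH.eq_two_iff h0]
    simp only [partSetoid_iff, hmem]
  have h1 : word P i = 1 ↔ w i = 1 := by
    rw [hP.word_eq_one_iff, hH.eq_one_iff]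
    simp only [partSetoid_iff, hmem]
  generalize word P i = a at h1 h2
  generalize w i = b at h1 h2
  revert a b
  decide

lemma card_isPath_le (n : ℕ) : Nat.card {w : Fin n → Fin 3 // IsPath w 0} ≤
    Nat.card {P : Finpartition (Finset.univ : Finset (Fin n)) // IsRiordanPartition P} := by
  choose g hg hw using fun w : {w : Fin n → Fin 3 // IsPath w 0} => w.2.exists_word_eq
  refine Nat.card_le_card_of_injective (fun w => ⟨g w, hg w⟩) fun v w hvw => Subtype.ext ?_
  have h : g v = g w := congrArg Subtype.val hvw
  rw [← hw v, ← hw w, h]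

/-! ### The basis -/

lemma linearIndependent_riordanValue (n : ℕ) : LinearIndependent ℚ
    fun P : {P : Finpartition (Finset.univ : Finset (Fin n)) // IsRiordanPartition P} =>
      riordanValue P.1 P.2 := by
  refine LinearIndependent.of_comp (code n).toLinearMap ?_
  refine linearIndependent_of_monic _ (fun P => (code_riordanValue P.1 P.2).1) ?_
  intro P Q hPQ
  have h : (code n (riordanValue P.1 P.2)).natDegree = (code n (riordanValue Q.1 Q.2)).natDegree :=
    hPQ
  rw [(code_riordanValue P.1 P.2).2, (code_riordanValue Q.1 Q.2).2] at h
  exact Subtype.ext (P.2.word_injective Q.2 (sum_rank_injective h))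

lemma range_riordanValue (n : ℕ) : (Set.range
    fun P : {P : Finpartition (Finset.univ : Finset (Fin n)) // IsRiordanPartition P} =>
      riordanValue P.1 P.2) = {w | ∃ T : JacobiDiagram n, IsRiordanTree T ∧ T.W = w} := by
  ext x
  constructor
  · rintro ⟨P, rfl⟩
    refine ⟨_, ⟨P.1, P.2, ⟨?_⟩⟩, rfl⟩
    exact JacobiDiagram.Iso.refl _
  · rintro ⟨T, ⟨P, hP, ⟨φ⟩⟩, rfl⟩
    exact ⟨⟨P, hP⟩, φ.W_eq.symm⟩

end RiordanTrees

end

theorem theorem3p2 (n : ℕ) :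
    LinearIndepOn ℚ id
      {w | ∃ T : RiordanTrees.JacobiDiagram n, RiordanTrees.IsRiordanTree T ∧ T.W = w} ∧
    Submodule.span ℚ
      {w | ∃ T : RiordanTrees.JacobiDiagram n, RiordanTrees.IsRiordanTree T ∧ T.W = w} =
        (RiordanTrees.Inv n).map (RiordanTrees.incl n) ∧
    (∀ T T' : RiordanTrees.JacobiDiagram n,
      RiordanTrees.IsRiordanTree T → RiordanTrees.IsRiordanTree T' →
        (T.W = T'.W ↔ Nonempty (T.Iso T'))) ∧
    (Module.finrank ℚ (RiordanTrees.Inv n) : ℚ) = RiordanTrees.riordanNumber n := by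
  open RiordanTrees in
  have hli := linearIndependent_riordanValue n
  have hfin : FiniteDimensional ℚ (TensorPower n) := (wordBasis n).finiteDimensional_of_finite
  have hcard : Nat.card {P : Finpartition (Finset.univ : Finset (Fin n)) // IsRiordanPartition P} =
      Module.finrank ℚ (Submodule.span ℚ (Set.range
        fun P : {P : Finpartition (Finset.univ : Finset (Fin n)) // IsRiordanPartition P} =>
          riordanValue P.1 P.2)) := by
    classical
    have := Fintype.ofFinite
      {P : Finpartition (Finset.univ : Finset (Fin n)) // IsRiordanPartition P}
    rw [finrank_span_eq_card hli, Nat.card_eq_fintype_card]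
  have hle : Submodule.span ℚ (Set.range
        fun P : {P : Finpartition (Finset.univ : Finset (Fin n)) // IsRiordanPartition P} =>
          riordanValue P.1 P.2) ≤ (Inv n).map (incl n) := by
    rw [Submodule.span_le]
    rintro _ ⟨P, rfl⟩
    exact riordanValue_mem P.1 P.2
  have hmap : Module.finrank ℚ ((Inv n).map (incl n)) = Module.finrank ℚ (Inv n) :=
    (Submodule.equivMapOfInjective _ incl_injective _).finrank_eq.symm
  have h1 := Submodule.finrank_mono hle
  have h2 := finrank_Inv_le n
  have h3 := card_isPath_le n
  -- The chain of inequalities closes up: the number of Riordan partitions is the rank of the span,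
  -- and it bounds the number of paths, hence the rank of the invariants, from above.
  have hspan := Submodule.eq_of_le_of_finrank_le hle (by omega)
  have hdim : Module.finrank ℚ (Inv n) = Nat.card {w : Fin n → Fin 3 // IsPath w 0} := by omega
  rw [← range_riordanValue]
  refine ⟨hli.linearIndepOn_id, hspan, ?_, ?_⟩
  · rintro T T' ⟨P, hP, ⟨φ⟩⟩ ⟨Q, hQ, ⟨ψ⟩⟩
    refine ⟨fun h => ?_, fun ⟨χ⟩ => χ.W_eq⟩
    have h' : riordanValue P hP = riordanValue Q hQ := φ.W_eq.symm.trans (h.trans ψ.W_eq)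
    -- An independent family is injective, so equal values come from the same partition, and both
    -- trees are isomorphic to its standard forest.
    have hPQ : P = Q := congrArg Subtype.val (hli.injective (a₁ := ⟨P, hP⟩) (a₂ := ⟨Q, hQ⟩) h')
    subst hPQ
    exact ⟨φ.trans ψ.symm⟩
  · have h4 := card_isPath n 0
    rw [hdim, h4, riordanNumber_eq]
    simp
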